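/- Let $n\ge 2$, let $\mathbf B^n$ be the open unit ball of $\mathbb R^n$ with boundary $\mathbb S^{n-1}$, let $\alpha\ge 0$ be real and let $p$ be an integer with $1\le p\le n-1$. Let $W^{1,p}(\mathbf B^n,\mathbb S^{n-1})$ be the set of maps $u\in W^{1,p}(\mathbf B^n,\mathbb R^n)$ with $\|u\|=1$ almost everywhere, and let $\mathcal A_p$ be the set of those $u\in W^{1,p}(\mathbf B^n,\mathbb S^{n-1})$ with $u(x)=x$ on $\mathbb S^{n-1}$ in the Sobolev sense, that is, $u-\mathrm{id}\in W^{1,p}_0(\mathbf B^n,\mathbb R^n)$, the closure of $C_c^\infty(\mathbf B^n,\mathbb R^n)$ in $W^{1,p}(\mathbf B^n,\mathbb R^n)$. For $u\in W^{1,p}(\mathbf B^n,\mathbb R^n)$ put $$E_{p,\alpha}(u)=\int_{\mathbf B^n}\|x\|^{\alpha}\,\|\nabla u(x)\|^p\,dx,$$ where $\nabla u$ is the weak Jacobian matrix and $\|\nabla u\|=\bigl(\sum_{i,j}(\partial_j u_i)^2\bigr)^{1/2}$. Then the map $u_0(x)=x/\|x\|$ belongs to $\mathcal A_p$, has finite energy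 $E_{p,\alpha}(u_0)<\infty$, and minimizes $E_{p,\alpha}$ over $\mathcal A_p$: $$E_{p,\alpha}(u_0)\le E_{p,\alpha}(u)\qquad\text{for all }u\in\mathcal A_p.$$ Moreover, if $\alpha>0$, then $u_0$ is the unique minimizer: for $u\in\mathcal A_p$, equality $E_{p,\alpha}(u)=E_{p,\alpha}(u_0)$ holds if and only if $u=u_0$ almost everywhere in $\mathbf B^n$. -/

import Mathlib

open MeasureTheory Filter Topology
open scoped ContDiff ENNReal

noncomputable section

namespace WeightedEnergy

/-- Euclidean space `ℝⁿ`. -/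
abbrev E (n : ℕ) : Type := EuclideanSpace ℝ (Fin n)

/-- The open unit ball `Bⁿ` of `ℝⁿ`. -/
def unitBall (n : ℕ) : Set (E n) := Metric.ball 0 1

/-- The classical partial derivative `∂ⱼ f`. -/
def partialDeriv {n : ℕ} (j : Fin n) (f : E n → ℝ) (x : E n) : ℝ :=
  fderiv ℝ f x (EuclideanSpace.single j 1)

/-- `g` is the weak (distributional) partial derivative `∂ⱼ f` on the open set `Ω`: both are
locally integrable on `Ω`, and `∫_Ω f ∂ⱼφ = - ∫_Ω g φ` for all test functions `φ ∈ C_c^∞(Ω)`. -/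
def HasWeakPartial {n : ℕ} (Ω : Set (E n)) (j : Fin n) (f g : E n → ℝ) : Prop :=
  LocallyIntegrableOn f Ω volume ∧ LocallyIntegrableOn g Ω volume ∧
    ∀ φ : E n → ℝ, ContDiff ℝ ∞ φ → HasCompactSupport φ → tsupport φ ⊆ Ω →
      ∫ x in Ω, f x * partialDeriv j φ x = - ∫ x in Ω, g x * φ x

/-- `G` is a weak Jacobian matrix of `u` on `Ω`: its entry `(i, j)` is the weak `∂ⱼ uᵢ`. -/
def IsWeakJacobian {n : ℕ} (Ω : Set (E n)) (u : E n → E n)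
    (G : E n → Matrix (Fin n) (Fin n) ℝ) : Prop :=
  ∀ i j, HasWeakPartial Ω j (fun x => u x i) (fun x => G x i j)

open Classical in
/-- The weak Jacobian matrix `∇u` of `u` on the open set `Ω`. It is determined almost everywhere
on `Ω`; a representative is chosen. (It is `0` by convention if there is no weak Jacobian.) -/
def weakJacobian {n : ℕ} (Ω : Set (E n)) (u : E n → E n) : E n → Matrix (Fin n) (Fin n) ℝ :=
  if h : ∃ G, IsWeakJacobian Ω u G then h.choose else 0

/-- The Sobolev space `W^{1,p}(Ω, ℝⁿ)`: `u` is in `L^p(Ω)` and has a weak Jacobian in `L^p(Ω)`. -/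
def MemSobolev {n : ℕ} (p : ℝ≥0∞) (Ω : Set (E n)) (u : E n → E n) : Prop :=
  MemLp u p (volume.restrict Ω) ∧ (∃ G, IsWeakJacobian Ω u G) ∧
    ∀ i j, MemLp (fun x => weakJacobian Ω u x i j) p (volume.restrict Ω)

/-- The space `W₀^{1,p}(Ω, ℝⁿ)`, the closure of `C_c^∞(Ω, ℝⁿ)` in `W^{1,p}(Ω, ℝⁿ)`. -/
def MemSobolevZero {n : ℕ} (p : ℝ≥0∞) (Ω : Set (E n)) (w : E n → E n) : Prop :=
  MemSobolev p Ω w ∧ ∃ φ : ℕ → E n → E n,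
    (∀ k, ContDiff ℝ ∞ (φ k) ∧ HasCompactSupport (φ k) ∧ tsupport (φ k) ⊆ Ω) ∧
    Tendsto (fun k => eLpNorm (fun x => φ k x - w x) p (volume.restrict Ω)) atTop (𝓝 0) ∧
    ∀ i j, Tendsto
      (fun k => eLpNorm (fun x => partialDeriv j (fun y => φ k y i) x - weakJacobian Ω w x i j) p
        (volume.restrict Ω)) atTop (𝓝 0)

/-- The maps `u ∈ W^{1,p}(Bⁿ, S^{n-1})`, that is `u ∈ W^{1,p}(Bⁿ, ℝⁿ)` with `‖u‖ = 1` almost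
everywhere, such that `u(x) = x` on `S^{n-1}` in the Sobolev sense: `u - id ∈ W₀^{1,p}(Bⁿ, ℝⁿ)`. -/
def Admissible (n : ℕ) (p : ℝ≥0∞) (u : E n → E n) : Prop :=
  MemSobolev p (unitBall n) u ∧
    (∀ᵐ x ∂(volume.restrict (unitBall n)), ‖u x‖ = 1) ∧
    MemSobolevZero p (unitBall n) (fun x => u x - x)

/-- The Euclidean (Hilbert–Schmidt) norm of a matrix. -/
def hsNorm {n : ℕ} (A : Matrix (Fin n) (Fin n) ℝ) : ℝ :=
  Real.sqrt (∑ i, ∑ j, A i j ^ 2)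

/-- The weighted energy `∫_{Bⁿ} r^α ‖∇u‖^p dx`, `r = ‖x‖`, as an element of `[0, ∞]`. -/
def energy (n : ℕ) (α p : ℝ) (u : E n → E n) : ℝ≥0∞ :=
  ∫⁻ x in unitBall n, ENNReal.ofReal (‖x‖ ^ α * hsNorm (weakJacobian (unitBall n) u x) ^ p)

/-- The map `u₀(x) = x / ‖x‖`. -/
def radialMap (n : ℕ) (x : E n) : E n := ‖x‖⁻¹ • x

end WeightedEnergy

end

/-! The proof is a calibration by a null Lagrangian. Let `σ_p` be the sum of the principal minors of
order `p`. The integral of `σ_p` of a Jacobian matrix depends only on boundary values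
(`setIntegral_sumMinors_jacobian_eq`). It is applied to the weighted map `‖x‖^β u` with `β = α / p`,
whose Jacobian is `‖x‖^β ∇u + u ⊗ ∇‖x‖^β`; the result is a number common to all admissible `u`
(`AdmissiblePair.integral_weighted_eq`).

Since `‖u‖ = 1`, the columns of `∇u` are orthogonal to `u` (`AdmissiblePair.tangent`). In an
orthonormal frame containing `u`, Hadamard's and Maclaurin's inequalities over the remaining `n - 1`
rows give, with `s = ‖∇u‖ / √(n-1)` and `ρ = 1 / ‖x‖`, the bound `σ_p ≤ ‖x‖^α (C(n-1,p) s^p + β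
C(n-1,p-1) ρ s^(p-1))` (`sumMinors_weighted_le`). For `u₀` this is an equality with `s = ρ`.
Weighted AM–GM, `p ρ s^(p-1) ≤ (p-1) s^p + ρ^p`, turns the right-hand side into a positive multiple
of the energy density of `u` plus a multiple of that of `u₀`; integrating yields minimality
(`AdmissiblePair.integral_energyDensity_le`).

For uniqueness with `α > 0`: if `p ≥ 2`, equality in AM–GM forces `‖∇u‖ = ‖∇u₀‖` almost everywhere,
so the energies with exponent one agree as well. If `p = 1`, they agree by assumption. With exponent
one the null Lagrangian is the divergence of `‖x‖^α u`, which contains `α ‖x‖^(α-1) ⟨u, u₀⟩`;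
equality of the energies forces `⟨u, u₀⟩ = 1`, hence `u = u₀` (`AdmissiblePair.ae_eq_radialMap`).

On the analytic side, minors of order `p` pass to the limit under `L^p` convergence of Jacobians,
and `1 / ‖x‖` lies in `L^p` of the ball because `p < n`. This justifies the singular weight and the
admissibility of `u₀`. -/

namespace WeightedEnergy

/-! ### Elementary symmetric functions and Maclaurin's inequality -/

section SymmetricFunctions

/-- The `k`-th elementary symmetric function of the family `a` over the finite set `s`. -/
def elemSymm {ι : Type*} (s : Finset ι) (a : ι → ℝ) (k : ℕ) : ℝ :=
  ∑ t ∈ s.powersetCard k, ∏ i ∈ t, a i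

variable {ι : Type*} {s : Finset ι} {a : ι → ℝ}

theorem elemSymm_nonneg (ha : ∀ i ∈ s, 0 ≤ a i) (k : ℕ) : 0 ≤ elemSymm s a k :=
  Finset.sum_nonneg fun _ ht => Finset.prod_nonneg fun i hi =>
    ha i ((Finset.mem_powersetCard.1 ht).1 hi)

theorem elemSymm_zero : elemSymm s a 0 = 1 := by simp [elemSymm]

theorem elemSymm_const (c : ℝ) (k : ℕ) :
    elemSymm s (fun _ => c) k = (s.card.choose k : ℝ) * c ^ k := by
  rw [elemSymm, Finset.sum_congr rfl (g := fun _ => c ^ k)]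
  · simp
  · intro t ht
    simp [(Finset.mem_powersetCard.1 ht).2]

theorem elemSymm_smul (c : ℝ) (k : ℕ) :
    elemSymm s (fun i => c * a i) k = c ^ k * elemSymm s a k := by
  rw [elemSymm, elemSymm, Finset.mul_sum]
  refine Finset.sum_congr rfl fun t ht => ?_
  rw [Finset.prod_mul_distrib, Finset.prod_const, (Finset.mem_powersetCard.1 ht).2]

variable [DecidableEq ι]

theorem elemSymm_insert {i : ι} (hi : i ∉ s) (k : ℕ) :
    elemSymm (insert i s) a (k + 1) = elemSymm s a (k + 1) + a i * elemSymm s a k := by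
  simp only [elemSymm]
  rw [Finset.powersetCard_succ_insert hi, Finset.sum_union, Finset.mul_sum, Finset.sum_image]
  · congr 1
    refine Finset.sum_congr rfl fun t ht => ?_
    rw [Finset.prod_insert fun h => hi ((Finset.mem_powersetCard.1 ht).1 h)]
  · intro t ht t' ht' h
    have h1 : i ∉ t := fun h => hi ((Finset.mem_powersetCard.1 ht).1 h)
    have h2 : i ∉ t' := fun h => hi ((Finset.mem_powersetCard.1 ht').1 h)
    rw [← Finset.erase_insert h1, ← Finset.erase_insert h2, h]
  · rw [Finset.disjoint_left]
    intro t ht ht'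
    obtain ⟨t', -, rfl⟩ := Finset.mem_image.1 ht'
    exact hi ((Finset.mem_powersetCard.1 ht).1 (Finset.mem_insert_self _ _))

/-- Double counting of the pairs `(t, i)` with `i ∈ t` and `t` of size `k + 1`: each product over
`t` arises once for each of its elements. -/
theorem sum_mul_elemSymm_erase (k : ℕ) :
    ∑ i ∈ s, a i * elemSymm (s.erase i) a k = (k + 1) * elemSymm s a (k + 1) := by
  have h : ((k : ℝ) + 1) * elemSymm s a (k + 1) =
      ∑ t ∈ s.powersetCard (k + 1), ∑ i ∈ t, ∏ j ∈ t, a j := by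
    rw [elemSymm, Finset.mul_sum]
    refine Finset.sum_congr rfl fun t ht => ?_
    simp [(Finset.mem_powersetCard.1 ht).2]
  rw [h]
  simp only [elemSymm, Finset.mul_sum]
  rw [Finset.sum_sigma', Finset.sum_sigma']
  refine Finset.sum_bij' (fun x _ => ⟨insert x.1 x.2, x.1⟩) (fun y _ => ⟨y.2, y.1.erase y.2⟩)
    ?_ ?_ ?_ ?_ ?_
  · rintro ⟨i, t⟩ h
    simp only [Finset.mem_sigma, Finset.mem_powersetCard] at h ⊢
    have hit : i ∉ t := fun h' => by simpa using h.2.1 h'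
    refine ⟨⟨Finset.insert_subset h.1 (h.2.1.trans (Finset.erase_subset _ _)), ?_⟩,
      Finset.mem_insert_self _ _⟩
    rw [Finset.card_insert_of_notMem hit, h.2.2]
  · rintro ⟨t, i⟩ h
    simp only [Finset.mem_sigma, Finset.mem_powersetCard] at h ⊢
    refine ⟨h.1.1 h.2, Finset.erase_subset_erase _ h.1.1, ?_⟩
    rw [Finset.card_erase_of_mem h.2, h.1.2, Nat.add_sub_cancel]
  · rintro ⟨i, t⟩ h
    simp only [Finset.mem_sigma, Finset.mem_powersetCard] at h
    have hit : i ∉ t := fun h' => by simpa using h.2.1 h'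
    simp [Finset.erase_insert hit]
  · rintro ⟨t, i⟩ h
    simp only [Finset.mem_sigma, Finset.mem_powersetCard] at h
    simp [Finset.insert_erase h.2]
  · rintro ⟨i, t⟩ h
    simp only [Finset.mem_sigma, Finset.mem_powersetCard] at h
    have hit : i ∉ t := fun h' => by simpa using h.2.1 h'
    simp [Finset.prod_insert hit]

/-- A `k`-subset `t` survives the removal of `i` exactly for the indices `i ∉ t`. The truncated
subtraction is harmless: for `k` above the cardinality both sides vanish. -/
theorem sum_elemSymm_erase (k : ℕ) :
    ∑ i ∈ s, elemSymm (s.erase i) a k = ((s.card - k : ℕ) : ℝ) * elemSymm s a k := by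
  have h : ((s.card - k : ℕ) : ℝ) * elemSymm s a k =
      ∑ t ∈ s.powersetCard k, ∑ i ∈ s \ t, ∏ j ∈ t, a j := by
    rw [elemSymm, Finset.mul_sum]
    refine Finset.sum_congr rfl fun t ht => ?_
    have ht := Finset.mem_powersetCard.1 ht
    rw [Finset.sum_const, Finset.card_sdiff_of_subset ht.1, ht.2, nsmul_eq_mul]
  rw [h]
  simp only [elemSymm]
  refine Finset.sum_comm' fun i t => ?_
  simp only [Finset.mem_powersetCard, Finset.mem_sdiff, Finset.subset_erase]
  tauto

/-- The two erased sets share all indices but one; expanding in that remaining variable, removing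
the larger value leaves the smaller sum. -/
theorem elemSymm_erase_le (ha : ∀ i ∈ s, 0 ≤ a i) {i j : ι} (hi : i ∈ s) (hj : j ∈ s)
    (hij : a i < a j) (k : ℕ) : elemSymm (s.erase j) a k ≤ elemSymm (s.erase i) a k := by
  have hne : i ≠ j := by rintro rfl; exact lt_irrefl _ hij
  cases k with
  | zero => simp [elemSymm_zero]
  | succ k =>
    have h1 : s.erase j = insert i ((s.erase j).erase i) :=
      (Finset.insert_erase (Finset.mem_erase.2 ⟨hne, hi⟩)).symm
    have h2 : s.erase i = insert j ((s.erase j).erase i) := by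
      rw [Finset.erase_right_comm]
      exact (Finset.insert_erase (Finset.mem_erase.2 ⟨hne.symm, hj⟩)).symm
    rw [h1, elemSymm_insert (by simp), h2, elemSymm_insert (by simp)]
    have := elemSymm_nonneg (s := (s.erase j).erase i) (a := a)
      (fun l hl => ha l (Finset.mem_of_mem_erase (Finset.mem_of_mem_erase hl))) k
    gcongr

/-- Maclaurin's inequality between the elementary symmetric functions and the mean. -/
theorem elemSymm_le_mean_pow (ha : ∀ i ∈ s, 0 ≤ a i) (k : ℕ) :
    elemSymm s a k ≤ (s.card.choose k : ℝ) * ((∑ i ∈ s, a i) / s.card) ^ k := by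
  rcases s.eq_empty_or_nonempty with rfl | hs
  · cases k with
    | zero => simp [elemSymm]
    | succ k => rw [elemSymm, Finset.powersetCard_eq_empty.2 (by simp)]; simp
  have hm : (0 : ℝ) < s.card := by exact_mod_cast hs.card_pos
  have hsum : 0 ≤ ∑ i ∈ s, a i := Finset.sum_nonneg ha
  induction k with
  | zero => simp [elemSymm_zero]
  | succ k ih =>
    -- Chebyshev's sum inequality for these oppositely ordered families, combined with the two
    -- counting identities, bounds `e_(k+1)` by a multiple of `(∑ a) e_k`; the induction iterates
    -- this bound.
    have hanti : AntivaryOn a (fun i => elemSymm (s.erase i) a k) s := by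
      intro i hi j hj hij
      by_contra! h
      exact absurd hij (not_lt.2 (elemSymm_erase_le ha hi hj h k))
    have h := hanti.card_mul_sum_le_sum_mul_sum
    rw [sum_mul_elemSymm_erase, sum_elemSymm_erase] at h
    have hc : ((s.card.choose (k + 1) : ℝ)) * (k + 1) = s.card.choose k * ((s.card - k : ℕ) : ℝ) := by
      exact_mod_cast Nat.choose_succ_right_eq s.card k
    have hk : (0 : ℝ) < k + 1 := by positivity
    have h2 : (s.card : ℝ) * ((k + 1) * elemSymm s a (k + 1)) ≤
        s.card * ((k + 1) * ((s.card.choose (k + 1) : ℝ) *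
          ((∑ i ∈ s, a i) / s.card) ^ (k + 1))) := by
      calc _ ≤ _ := h
        _ ≤ (∑ i ∈ s, a i) * (((s.card - k : ℕ) : ℝ) *
            ((s.card.choose k : ℝ) * ((∑ i ∈ s, a i) / s.card) ^ k)) := by gcongr
        _ = (∑ i ∈ s, a i) * ((s.card.choose (k + 1) : ℝ) * (k + 1)) *
            ((∑ i ∈ s, a i) / s.card) ^ k := by rw [hc]; ring
        _ = _ := by rw [pow_succ]; field_simp
    exact le_of_mul_le_mul_left (le_of_mul_le_mul_left h2 hm) hk

/-- By Cauchy–Schwarz the arithmetic mean is at most the quadratic mean. The quadratic form is the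
useful one, because the Euclidean norm of a matrix is the sum of squares of its row norms. -/
theorem elemSymm_le_rms_pow (ha : ∀ i ∈ s, 0 ≤ a i) (k : ℕ) :
    elemSymm s a k ≤ (s.card.choose k : ℝ) * (√(∑ i ∈ s, a i ^ 2) / √s.card) ^ k := by
  refine (elemSymm_le_mean_pow ha k).trans ?_
  have hsum : 0 ≤ ∑ i ∈ s, a i := Finset.sum_nonneg ha
  rw [← Real.sqrt_div (Finset.sum_nonneg fun i _ => sq_nonneg _)]
  gcongr
  apply Real.le_sqrt_of_sq_le
  rcases s.eq_empty_or_nonempty with rfl | hs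
  · simp
  have hm : (0 : ℝ) < s.card := by exact_mod_cast hs.card_pos
  rw [div_pow, div_le_div_iff₀ (by positivity) hm]
  have := sq_sum_le_card_mul_sum_sq (s := s) (f := a)
  nlinarith

end SymmetricFunctions

/-! ### Sums of principal minors: Hadamard bound, similarity invariance, tangential matrices -/

section PrincipalMinors

open Matrix

/-- Up to sign the determinant is the Euclidean volume form evaluated at the rows, and a volume form
is bounded by the product of the norms. -/
theorem abs_det_le_prod_row_norm_fin {m : ℕ} (M : Matrix (Fin m) (Fin m) ℝ) :
    |M.det| ≤ ∏ i, √(∑ j, M i j ^ 2) := by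
  have : Fact (Module.finrank ℝ (EuclideanSpace ℝ (Fin m)) = m) := ⟨by simp⟩
  have h := (EuclideanSpace.basisFun (Fin m) ℝ).toBasis.orientation.abs_volumeForm_apply_le
    (fun i => WithLp.toLp 2 (M i))
  rw [Orientation.volumeForm_robust _ (EuclideanSpace.basisFun (Fin m) ℝ) rfl] at h
  rw [Module.Basis.det_apply] at h
  have h2 : (EuclideanSpace.basisFun (Fin m) ℝ).toBasis.toMatrix (fun i => WithLp.toLp 2 (M i)) =
      Mᵀ := by
    ext i j
    simp [Module.Basis.toMatrix_apply]
  rw [h2, det_transpose] at h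
  simpa [EuclideanSpace.norm_eq] using h

/-- Hadamard's inequality. -/
theorem abs_det_le_prod_row_norm {ι : Type*} [Fintype ι] [DecidableEq ι] (M : Matrix ι ι ℝ) :
    |M.det| ≤ ∏ i, √(∑ j, M i j ^ 2) := by
  let e := Fintype.equivFin ι
  have h := abs_det_le_prod_row_norm_fin (M.submatrix e.symm e.symm)
  rw [det_submatrix_equiv_self] at h
  refine h.trans_eq ?_
  rw [← e.symm.prod_comp]
  refine Finset.prod_congr rfl fun i _ => ?_
  rw [← e.symm.sum_comp (fun j => M (e.symm i) j ^ 2)]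
  rfl

/-- The sum of the principal minors of order `k`. -/
def sumMinors {n : ℕ} (k : ℕ) (M : Matrix (Fin n) (Fin n) ℝ) : ℝ :=
  ∑ s ∈ Finset.univ.powersetCard k,
    (M.submatrix (Subtype.val : s → Fin n) (Subtype.val : s → Fin n)).det

variable {n : ℕ}

/-- Hadamard's inequality for each principal submatrix; its rows are truncations of rows of `M`,
hence no longer than these. -/
theorem sumMinors_le_elemSymm (M : Matrix (Fin n) (Fin n) ℝ) (k : ℕ) :
    sumMinors k M ≤ elemSymm Finset.univ (fun i => √(∑ j, M i j ^ 2)) k := by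
  refine Finset.sum_le_sum fun s _ => (le_abs_self _).trans ?_
  refine (abs_det_le_prod_row_norm _).trans ?_
  rw [← Finset.prod_coe_sort s]
  refine Finset.prod_le_prod (fun _ _ => Real.sqrt_nonneg _) fun i _ => ?_
  refine Real.sqrt_le_sqrt ?_
  simp only [submatrix_apply]
  rw [Finset.sum_coe_sort s (fun j => M i j ^ 2)]
  exact Finset.sum_le_sum_of_subset_of_nonneg (Finset.subset_univ _) fun _ _ _ => sq_nonneg _

theorem sumMinors_diagonal (d : Fin n → ℝ) (k : ℕ) :
    sumMinors k (diagonal d) = elemSymm Finset.univ d k := by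
  refine Finset.sum_congr rfl fun s _ => ?_
  rw [submatrix_diagonal _ _ Subtype.val_injective, det_diagonal]
  exact Finset.prod_coe_sort s d

theorem sumMinors_one (M : Matrix (Fin n) (Fin n) ℝ) : sumMinors 1 M = M.trace := by
  rw [sumMinors, ← coeff_det_one_add_X_smul_eq_sum_minors, coeff_det_one_add_X_smul_one]

/-- The sum of the principal minors is invariant under similarity. -/
theorem sumMinors_conj {P Q M : Matrix (Fin n) (Fin n) ℝ} (h : Q * P = 1) (k : ℕ) :
    sumMinors k (P * M * Q) = sumMinors k M := by
  -- The sums of principal minors are the coefficients of `det (1 + X M)`, a polynomial unchanged by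
  -- conjugation.
  have h' : P * Q = 1 := mul_eq_one_comm.1 h
  rw [sumMinors, sumMinors, ← coeff_det_one_add_X_smul_eq_sum_minors,
    ← coeff_det_one_add_X_smul_eq_sum_minors]
  congr 1
  have hC : P.map Polynomial.C * Q.map Polynomial.C = (1 : Matrix (Fin n) (Fin n) (Polynomial ℝ)) := by
    rw [← Matrix.map_mul, h', Matrix.map_one _ (map_zero _) (map_one _)]
  have : 1 + (Polynomial.X : Polynomial ℝ) • (P * M * Q).map Polynomial.C =
      P.map Polynomial.C * (1 + (Polynomial.X : Polynomial ℝ) • M.map Polynomial.C) *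
        Q.map Polynomial.C := by
    rw [Matrix.map_mul, Matrix.map_mul, Matrix.mul_add, Matrix.add_mul, Matrix.mul_one, hC,
      Matrix.mul_smul, Matrix.smul_mul]
  rw [this, det_mul, det_mul, mul_right_comm, ← det_mul, hC, det_one, one_mul]

/-- The rows of `Q` form an orthonormal basis extending `u`, placed at index `i₀`. Conjugating by
`Q` reduces statements about `u` to the case of a basis vector. -/
theorem exists_rotation (u : E n) (hu : ‖u‖ = 1) :
    ∃ (Q : Matrix (Fin n) (Fin n) ℝ) (i₀ : Fin n), Q * Qᵀ = 1 ∧ Qᵀ * Q = 1 ∧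
      Q *ᵥ u = Pi.single i₀ 1 ∧ u ᵥ* Qᵀ = Pi.single i₀ 1 ∧ ∀ j, Q i₀ j = u j := by
  have hn : 0 < n := by
    rcases Nat.eq_zero_or_pos n with rfl | h
    · rw [Subsingleton.elim u 0, norm_zero] at hu
      exact absurd hu zero_ne_one
    · exact h
  let i₀ : Fin n := ⟨0, hn⟩
  have hon : Orthonormal ℝ (({i₀} : Set (Fin n)).domRestrict fun _ => u) := by
    rw [orthonormal_iff_ite]
    rintro ⟨i, hi⟩ ⟨j, hj⟩
    obtain rfl := hi
    obtain rfl := hj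
    simp [Set.domRestrict_apply, hu]
  obtain ⟨b, hb⟩ := hon.exists_orthonormalBasis_extension_of_card_eq (by simp)
  have hb0 : b i₀ = u := hb i₀ rfl
  have hinner : ∀ i j, ∑ l, b i l * b j l = if i = j then 1 else 0 := by
    intro i j
    rw [← b.inner_eq_ite i j, PiLp.inner_apply]
    simp [mul_comm]
  let Q : Matrix (Fin n) (Fin n) ℝ := Matrix.of fun i j => b i j
  have hQ : Q * Qᵀ = 1 := by
    ext i j
    simpa [Matrix.mul_apply, Matrix.one_apply, Q] using hinner i j
  have h1 : Q *ᵥ u = Pi.single i₀ 1 := by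
    ext i
    have := hinner i i₀
    rw [hb0] at this
    simpa [Matrix.mulVec, dotProduct, Q, Pi.single_apply] using this
  refine ⟨Q, i₀, hQ, mul_eq_one_comm.1 hQ, h1, ?_, fun j => by simp [Q, hb0]⟩
  rw [vecMul_transpose, h1]

theorem sum_row_sq (X : Matrix (Fin n) (Fin n) ℝ) (i : Fin n) :
    ∑ j, X i j ^ 2 = (X * Xᵀ) i i := by
  simp [Matrix.mul_apply, sq]

theorem sum_row_sq_mul {X Q : Matrix (Fin n) (Fin n) ℝ} (hQ : Qᵀ * Q = 1) (i : Fin n) :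
    ∑ j, (X * Qᵀ) i j ^ 2 = ∑ j, X i j ^ 2 := by
  rw [sum_row_sq, sum_row_sq, transpose_mul, transpose_transpose, ← Matrix.mul_assoc,
    Matrix.mul_assoc X, hQ, Matrix.mul_one]

theorem sum_sq_mul {X Q : Matrix (Fin n) (Fin n) ℝ} (hQ : Qᵀ * Q = 1) :
    ∑ i, ∑ j, (Q * X) i j ^ 2 = ∑ i, ∑ j, X i j ^ 2 := by
  have h : ∀ Y : Matrix (Fin n) (Fin n) ℝ, ∑ i, ∑ j, Y i j ^ 2 = (Y * Yᵀ).trace := fun Y => by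
    simp only [sum_row_sq]; rfl
  rw [h, h, transpose_mul, Matrix.mul_assoc, trace_mul_comm, Matrix.mul_assoc, Matrix.mul_assoc,
    hQ, Matrix.mul_one]

theorem elemSymm_univ_eq (a : Fin n → ℝ) (i₀ : Fin n) (k : ℕ) :
    elemSymm Finset.univ a (k + 1) = elemSymm (Finset.univ.erase i₀) a (k + 1) +
      a i₀ * elemSymm (Finset.univ.erase i₀) a k := by
  rw [← elemSymm_insert (by simp), Finset.insert_erase (Finset.mem_univ _)]

theorem elemSymm_congr {ι : Type*} {s : Finset ι} {a b : ι → ℝ} (h : ∀ i ∈ s, a i = b i) (k : ℕ) :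
    elemSymm s a k = elemSymm s b k :=
  Finset.sum_congr rfl fun _ ht => Finset.prod_congr rfl fun i hi =>
    h i ((Finset.mem_powersetCard.1 ht).1 hi)

theorem hsNorm_nonneg (A : Matrix (Fin n) (Fin n) ℝ) : 0 ≤ hsNorm A := Real.sqrt_nonneg _

/-- The sum of the principal minors of `h • A + u ⊗ g`, where the columns of `A` are orthogonal to
the unit vector `u`. -/
theorem sumMinors_le (u : E n) (hu : ‖u‖ = 1) (A : Matrix (Fin n) (Fin n) ℝ)
    (hA : ∀ j, ∑ i, u i * A i j = 0) (g : E n) {h : ℝ} (hh : 0 ≤ h) (k : ℕ) :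
    sumMinors (k + 1) (Matrix.of fun i j => h * A i j + u i * g j) ≤
      ((n - 1).choose (k + 1) : ℝ) * (h * (hsNorm A / √((n - 1 : ℕ) : ℝ))) ^ (k + 1) +
        ‖g‖ * (((n - 1).choose k : ℝ) * (h * (hsNorm A / √((n - 1 : ℕ) : ℝ))) ^ k) := by
  obtain ⟨Q, i₀, hQ, hQ', hQu, -, hQ0⟩ := exists_rotation u hu
  set M : Matrix (Fin n) (Fin n) ℝ := Matrix.of fun i j => h * A i j + u i * g j
  rw [← sumMinors_conj hQ' k.succ (P := Q) (Q := Qᵀ) (M := M)]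
  refine (sumMinors_le_elemSymm _ _).trans ?_
  -- In the rotated frame, orthogonality kills row `i₀` of `Q * A`. Thus row `i₀` of `Q * M` is `g`
  -- alone, and no other row involves `g`.
  have hrow : ∀ i j, (Q * M) i j = h * (Q * A) i j + (Pi.single i₀ 1 : Fin n → ℝ) i * g j := by
    intro i j
    rw [← hQu]
    simp only [Matrix.mul_apply, Matrix.mulVec, dotProduct, M, Matrix.of_apply, mul_add,
      Finset.sum_add_distrib, Finset.mul_sum, Finset.sum_mul]
    congr 1 <;> exact Finset.sum_congr rfl fun l _ => by ring
  have hQA0 : ∀ j, (Q * A) i₀ j = 0 := fun j => by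
    simpa [Matrix.mul_apply, hQ0] using hA j
  obtain ⟨r, hrdef⟩ : ∃ r : Fin n → ℝ, ∀ i, r i = √(∑ j, (Q * A) i j ^ 2) := ⟨_, fun _ => rfl⟩
  have hr : ∀ i, 0 ≤ r i := fun i => hrdef i ▸ Real.sqrt_nonneg _
  have hnorm0 : √(∑ j, (Q * M * Qᵀ) i₀ j ^ 2) = ‖g‖ := by
    rw [sum_row_sq_mul hQ', EuclideanSpace.norm_eq]
    simp [hrow, hQA0]
  have hnorm : ∀ i ∈ Finset.univ.erase i₀, √(∑ j, (Q * M * Qᵀ) i j ^ 2) = h * r i := by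
    intro i hi
    rw [sum_row_sq_mul hQ']
    simp only [hrow, Pi.single_eq_of_ne (Finset.ne_of_mem_erase hi), zero_mul, add_zero, mul_pow,
      ← Finset.mul_sum]
    rw [Real.sqrt_mul (sq_nonneg _), Real.sqrt_sq hh, hrdef]
  have hcard : (Finset.univ.erase i₀).card = n - 1 := by simp
  have hsum : √(∑ i ∈ Finset.univ.erase i₀, r i ^ 2) ≤ hsNorm A := by
    rw [hsNorm, ← sum_sq_mul hQ']
    refine Real.sqrt_le_sqrt ?_
    refine (Finset.sum_le_sum_of_subset_of_nonneg (Finset.subset_univ _)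
      fun _ _ _ => sq_nonneg _).trans_eq ?_
    refine Finset.sum_congr rfl fun i _ => ?_
    rw [hrdef]
    exact Real.sq_sqrt (Finset.sum_nonneg fun _ _ => sq_nonneg _)
  have hel : ∀ m, elemSymm (Finset.univ.erase i₀) r m ≤
      ((n - 1).choose m : ℝ) * (hsNorm A / √((n - 1 : ℕ) : ℝ)) ^ m := by
    intro m
    refine (elemSymm_le_rms_pow (fun i _ => hr i) m).trans ?_
    rw [hcard]
    have h1 : √(∑ i ∈ Finset.univ.erase i₀, r i ^ 2) / √((n - 1 : ℕ) : ℝ) ≤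
        hsNorm A / √((n - 1 : ℕ) : ℝ) := div_le_div_of_nonneg_right hsum (Real.sqrt_nonneg _)
    have h0 : 0 ≤ √(∑ i ∈ Finset.univ.erase i₀, r i ^ 2) / √((n - 1 : ℕ) : ℝ) :=
      div_nonneg (Real.sqrt_nonneg _) (Real.sqrt_nonneg _)
    exact mul_le_mul_of_nonneg_left (pow_le_pow_left₀ h0 h1 m) (Nat.cast_nonneg _)
  -- Splitting off row `i₀` leaves symmetric functions of `n - 1` row norms, which is the source of
  -- the binomials in `n - 1`.
  rw [elemSymm_univ_eq _ i₀, elemSymm_congr hnorm, elemSymm_congr hnorm, hnorm0, elemSymm_smul,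
    elemSymm_smul, mul_pow, mul_pow, mul_left_comm ((n - 1).choose (k + 1) : ℝ),
    mul_left_comm ((n - 1).choose k : ℝ)]
  have h1 := hel (k + 1)
  have h2 := hel k
  exact add_le_add (mul_le_mul_of_nonneg_left h1 (pow_nonneg hh _))
    (mul_le_mul_of_nonneg_left (mul_le_mul_of_nonneg_left h2 (pow_nonneg hh _)) (norm_nonneg _))

/-- The sum of the principal minors of `a • (1 - u ⊗ u) + c • (u ⊗ u)`. -/
theorem sumMinors_projection (u : E n) (hu : ‖u‖ = 1) (a c : ℝ) (k : ℕ) :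
    sumMinors (k + 1) (Matrix.of fun i j => a * ((if i = j then 1 else 0) - u i * u j) +
      c * (u i * u j)) =
      ((n - 1).choose (k + 1) : ℝ) * a ^ (k + 1) + c * (((n - 1).choose k : ℝ) * a ^ k) := by
  obtain ⟨Q, i₀, hQ, hQ', hQu, huQ, -⟩ := exists_rotation u hu
  have hM : (Matrix.of fun i j => a * ((if i = j then 1 else 0) - u i * u j) +
      c * (u i * u j)) = a • (1 : Matrix (Fin n) (Fin n) ℝ) + (c - a) • vecMulVec u u := by
    ext i j
    simp only [Matrix.of_apply, Matrix.add_apply, Matrix.smul_apply, Matrix.one_apply,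
      vecMulVec_apply, smul_eq_mul]
    ring
  have hD : Q * (a • (1 : Matrix (Fin n) (Fin n) ℝ) + (c - a) • vecMulVec u u) * Qᵀ =
      diagonal fun i => if i = i₀ then c else a := by
    rw [Matrix.mul_add, Matrix.add_mul, Matrix.mul_smul, Matrix.mul_smul, Matrix.mul_one,
      Matrix.smul_mul, Matrix.smul_mul, hQ, mul_vecMulVec, vecMulVec_mul, hQu, huQ]
    ext i j
    simp only [Matrix.add_apply, Matrix.smul_apply, Matrix.one_apply, vecMulVec_apply, smul_eq_mul,
      Matrix.diagonal_apply, Pi.single_apply]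
    split_ifs <;> simp_all
  rw [hM, ← sumMinors_conj hQ' (k + 1) (P := Q) (Q := Qᵀ), hD, sumMinors_diagonal,
    elemSymm_univ_eq _ i₀]
  have hc : ∀ i ∈ Finset.univ.erase i₀, (if i = i₀ then c else a) = a := fun i hi => by
    simp [Finset.ne_of_mem_erase hi]
  rw [elemSymm_congr hc, elemSymm_congr hc, elemSymm_const, elemSymm_const]
  simp

end PrincipalMinors

/-! ### Minors of smooth Jacobians as null Lagrangians -/

section NullLagrangian

open Matrix

variable {n : ℕ} {ι : Type*} [Fintype ι] [DecidableEq ι]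

theorem contDiff_fderiv_apply {f : E n → ℝ} (hf : ContDiff ℝ ∞ f) (v : E n) :
    ContDiff ℝ ∞ fun x => fderiv ℝ f x v :=
  (hf.fderiv_right (m := ∞) (by simp)).clm_apply contDiff_const

theorem hasCompactSupport_fderiv_apply {f : E n → ℝ} (hf : HasCompactSupport f) (v : E n) :
    HasCompactSupport fun x => fderiv ℝ f x v :=
  (hf.fderiv ℝ).comp_left (g := fun L : E n →L[ℝ] ℝ => L v) rfl

theorem fderiv_fderiv_apply_symm {f : E n → ℝ} (hf : ContDiff ℝ ∞ f) (v w x : E n) :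
    fderiv ℝ (fun y => fderiv ℝ f y v) x w = fderiv ℝ (fun y => fderiv ℝ f y w) x v := by
  have hd : DifferentiableAt ℝ (fderiv ℝ f) x :=
    (hf.fderiv_right (m := ∞) (by simp)).differentiable (by simp) x
  have key : ∀ a b : E n, fderiv ℝ (fun y => fderiv ℝ f y a) x b =
      fderiv ℝ (fderiv ℝ f) x b a := fun a b => by
    rw [fderiv_clm_apply hd (differentiableAt_const a)]
    simp
  rw [key, key]
  exact (hf.contDiffAt.isSymmSndFDerivAt
    (by simpa using WithTop.coe_le_coe.2 (le_top : (2 : ℕ∞) ≤ ⊤))).eq w v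

/-- Integration by parts for products of first derivatives, one factor of which has compact
support. -/
theorem integral_prod_fderiv (e : ι → E n) (w : ι → E n → ℝ) (hw : ∀ i, ContDiff ℝ ∞ (w i))
    (i₀ : ι) (hi₀ : HasCompactSupport (w i₀)) :
    Integrable (fun x => ∏ i, fderiv ℝ (w i) x (e i)) ∧
    (∀ k, Integrable fun x => w i₀ x *
      ((∏ i ∈ (Finset.univ.erase i₀).erase k, fderiv ℝ (w i) x (e i)) *
        fderiv ℝ (fun y => fderiv ℝ (w k) y (e k)) x (e i₀))) ∧
    ∫ x, ∏ i, fderiv ℝ (w i) x (e i) = - ∑ k ∈ Finset.univ.erase i₀, ∫ x, w i₀ x *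
      ((∏ i ∈ (Finset.univ.erase i₀).erase k, fderiv ℝ (w i) x (e i)) *
        fderiv ℝ (fun y => fderiv ℝ (w k) y (e k)) x (e i₀)) := by
  have hD : ∀ i, ContDiff ℝ ∞ fun x => fderiv ℝ (w i) x (e i) := fun i =>
    contDiff_fderiv_apply (hw i) _
  have hP : ∀ s : Finset ι, ContDiff ℝ ∞ fun x => ∏ i ∈ s, fderiv ℝ (w i) x (e i) := fun s =>
    contDiff_prod fun i _ => hD i
  have hfd : ∀ x, fderiv ℝ (fun x => ∏ i ∈ Finset.univ.erase i₀, fderiv ℝ (w i) x (e i)) x (e i₀) =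
      ∑ k ∈ Finset.univ.erase i₀,
        (∏ i ∈ (Finset.univ.erase i₀).erase k, fderiv ℝ (w i) x (e i)) *
        fderiv ℝ (fun y => fderiv ℝ (w k) y (e k)) x (e i₀) := by
    intro x
    have := HasFDerivAt.finsetProd (u := Finset.univ.erase i₀) (x := x)
      (g := fun i y => fderiv ℝ (w i) y (e i))
      (fun i _ => ((hD i).differentiable (by simp) x).hasFDerivAt)
    rw [this.fderiv]
    simp
  have hint : ∀ k, Integrable fun x => w i₀ x *
      ((∏ i ∈ (Finset.univ.erase i₀).erase k, fderiv ℝ (w i) x (e i)) *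
        fderiv ℝ (fun y => fderiv ℝ (w k) y (e k)) x (e i₀)) := fun k =>
    Continuous.integrable_of_hasCompactSupport
      ((hw i₀).continuous.mul ((hP _).continuous.mul
        (contDiff_fderiv_apply (hD k) _).continuous)) hi₀.mul_right
  have hsplit : ∀ x, ∏ i, fderiv ℝ (w i) x (e i) = fderiv ℝ (w i₀) x (e i₀) *
      ∏ i ∈ Finset.univ.erase i₀, fderiv ℝ (w i) x (e i) := fun x =>
    (Finset.mul_prod_erase _ _ (Finset.mem_univ i₀)).symm
  have hint1 : Integrable fun x => fderiv ℝ (w i₀) x (e i₀) *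
      ∏ i ∈ Finset.univ.erase i₀, fderiv ℝ (w i) x (e i) :=
    Continuous.integrable_of_hasCompactSupport ((hD i₀).continuous.mul (hP _).continuous)
      (hasCompactSupport_fderiv_apply hi₀ _).mul_right
  simp only [hsplit]
  refine ⟨hint1, hint, ?_⟩
  rw [← integral_finsetSum _ fun k _ => hint k, ← neg_eq_iff_eq_neg,
    ← integral_mul_fderiv_eq_neg_fderiv_mul_of_integrable hint1 ?_ ?_ ?_ ?_]
  · simp only [hfd, Finset.mul_sum]
  · simp only [hfd, Finset.mul_sum]
    exact integrable_finsetSum _ fun k _ => hint k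
  · exact Continuous.integrable_of_hasCompactSupport ((hw i₀).continuous.mul (hP _).continuous)
      hi₀.mul_right
  · exact fun x _ => (hw i₀).differentiable (by simp) x
  · exact fun x _ => (hP _).differentiable (by simp) x

/-- The integral of a Jacobian determinant vanishes if one of the functions has compact support. -/
theorem integral_det_fderiv_eq_zero (e : ι → E n) (w : ι → E n → ℝ)
    (hw : ∀ i, ContDiff ℝ ∞ (w i)) (i₀ : ι) (hi₀ : HasCompactSupport (w i₀)) :
    Integrable (fun x => (Matrix.of fun i j => fderiv ℝ (w i) x (e j)).det) ∧
    ∫ x, (Matrix.of fun i j => fderiv ℝ (w i) x (e j)).det = 0 := by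
  have hdet : ∀ x, (Matrix.of fun i j => fderiv ℝ (w i) x (e j)).det =
      ∑ σ : Equiv.Perm ι, ((σ.sign : ℤ) : ℝ) * ∏ i, fderiv ℝ (w i) x (e (σ i)) := by
    intro x
    rw [← det_transpose, det_apply']
    rfl
  simp only [hdet]
  have key := fun σ : Equiv.Perm ι => integral_prod_fderiv (fun i => e (σ i)) w hw i₀ hi₀
  have hint : ∀ σ : Equiv.Perm ι, Integrable fun x =>
      ((σ.sign : ℤ) : ℝ) * ∏ i, fderiv ℝ (w i) x (e (σ i)) := fun σ => (key σ).1.const_mul _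
  refine ⟨integrable_finsetSum _ fun σ _ => hint σ, ?_⟩
  rw [integral_finsetSum _ fun σ _ => hint σ]
  simp only [integral_const_mul, (key _).2.2, mul_neg, Finset.mul_sum, Finset.sum_neg_distrib]
  rw [Finset.sum_comm, neg_eq_zero]
  refine Finset.sum_eq_zero fun k hk => ?_
  have hk0 : k ≠ i₀ := Finset.ne_of_mem_erase hk
  set F : Equiv.Perm ι → ℝ := fun σ => ((σ.sign : ℤ) : ℝ) * ∫ x, w i₀ x *
      ((∏ i ∈ (Finset.univ.erase i₀).erase k, fderiv ℝ (w i) x (e (σ i))) *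
        fderiv ℝ (fun y => fderiv ℝ (w k) y (e (σ k))) x (e (σ i₀))) with hF
  -- Swapping `i₀` and `k` reverses the sign of the permutation but preserves the integral, by
  -- symmetry of the second derivatives of `w k`. The terms therefore cancel in pairs.
  have hswap : ∀ σ, F (σ * Equiv.swap i₀ k) = - F σ := by
    intro σ
    simp only [hF, Equiv.Perm.sign_mul, Equiv.Perm.sign_swap hk0.symm, Equiv.Perm.mul_apply,
      Equiv.swap_apply_left, Equiv.swap_apply_right]
    have h1 : ∀ x, ∏ i ∈ (Finset.univ.erase i₀).erase k,
        fderiv ℝ (w i) x (e (σ (Equiv.swap i₀ k i))) =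
        ∏ i ∈ (Finset.univ.erase i₀).erase k, fderiv ℝ (w i) x (e (σ i)) := by
      intro x
      refine Finset.prod_congr rfl fun i hi => ?_
      rw [Equiv.swap_apply_of_ne_of_ne (Finset.ne_of_mem_erase (Finset.mem_of_mem_erase hi))
        (Finset.ne_of_mem_erase hi)]
    simp only [h1, fderiv_fderiv_apply_symm (hw k) (e (σ i₀)) (e (σ k))]
    push_cast
    ring
  have hsum : ∑ σ, F σ = - ∑ σ, F σ := by
    have h := Equiv.sum_comp (Equiv.mulRight (Equiv.swap i₀ k)) F
    simp only [Equiv.coe_mulRight, hswap, Finset.sum_neg_distrib] at h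
    exact h.symm
  linarith

/-- The classical Jacobian matrix. -/
noncomputable def jacobian (V : E n → E n) (x : E n) : Matrix (Fin n) (Fin n) ℝ :=
  Matrix.of fun i j => partialDeriv j (fun y => V y i) x

theorem contDiff_coord {V : E n → E n} (hV : ContDiff ℝ ∞ V) (i : Fin n) :
    ContDiff ℝ ∞ fun y => V y i :=
  contDiff_euclidean.1 hV i

theorem continuous_jacobian {V : E n → E n} (hV : ContDiff ℝ ∞ V) (i j : Fin n) :
    Continuous fun x => jacobian V x i j :=
  (contDiff_fderiv_apply (contDiff_coord hV i) _).continuous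

theorem continuous_sumMinors_jacobian {V : E n → E n} (hV : ContDiff ℝ ∞ V) (k : ℕ) :
    Continuous fun x => sumMinors k (jacobian V x) := by
  refine continuous_finsetSum _ fun s _ => Continuous.matrix_det ?_
  exact continuous_matrix fun i j => continuous_jacobian hV i j

/-- Write `W = V + c` with `c` compactly supported and expand each minor by multilinearity in the
rows. The term without rows from `c` is the minor of `V`; every other term is a Jacobian determinant
with a compactly supported component, so its integral is zero. The minors themselves need not be
integrable on the whole space, hence the difference under the integral. -/
theorem integral_sumMinors_jacobian_sub {V W : E n → E n} (hV : ContDiff ℝ ∞ V)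
    (hW : ContDiff ℝ ∞ W) (hVW : HasCompactSupport fun x => W x - V x) (k : ℕ) :
    ∫ x, (sumMinors k (jacobian W x) - sumMinors k (jacobian V x)) = 0 := by
  have hs : ∀ s : Finset (Fin n),
      Integrable (fun x => ((jacobian W x).submatrix (Subtype.val : s → Fin n) Subtype.val).det -
        ((jacobian V x).submatrix (Subtype.val : s → Fin n) Subtype.val).det) ∧
      ∫ x, (((jacobian W x).submatrix (Subtype.val : s → Fin n) Subtype.val).det -
        ((jacobian V x).submatrix (Subtype.val : s → Fin n) Subtype.val).det) = 0 := by
    intro s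
    set c : s → E n → ℝ := fun i x => W x i - V x i
    set a : s → E n → ℝ := fun i x => V x i
    have hc : ∀ i, ContDiff ℝ ∞ (c i) := fun i => (contDiff_coord hW _).sub (contDiff_coord hV _)
    have ha : ∀ i, ContDiff ℝ ∞ (a i) := fun i => contDiff_coord hV _
    have hcs : ∀ i, HasCompactSupport (c i) := fun i =>
      hVW.comp_left (g := fun z : E n => z i) rfl
    let e : s → E n := fun j => EuclideanSpace.single (j : Fin n) 1
    have hdiff : ∀ x, ((jacobian W x).submatrix (Subtype.val : s → Fin n) Subtype.val).det -
        ((jacobian V x).submatrix (Subtype.val : s → Fin n) Subtype.val).det =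
        ∑ t ∈ Finset.univ.erase (∅ : Finset s),
          (Matrix.of fun i j => fderiv ℝ (t.piecewise c a i) x (e j)).det := by
      intro x
      have h1 : (jacobian W x).submatrix (Subtype.val : s → Fin n) Subtype.val =
          (fun i j => fderiv ℝ (c i) x (e j)) + fun i j => fderiv ℝ (a i) x (e j) := by
        ext i j
        have : (fun y => W y i) = c i + a i := by
          funext y
          simp [c, a]
        simp only [submatrix_apply, jacobian, of_apply, partialDeriv, Pi.add_apply, this]
        rw [fderiv_add ((hc i).differentiable (by simp) x) ((ha i).differentiable (by simp) x)]
        rfl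
      have h2 := (detRowAlternating (R := ℝ) (n := s)).map_add_univ
        (fun i j => fderiv ℝ (c i) x (e j)) (fun i j => fderiv ℝ (a i) x (e j))
      rw [h1]
      change detRowAlternating _ - _ = _
      rw [h2, ← Finset.add_sum_erase _ _ (Finset.mem_univ (∅ : Finset s)), Finset.piecewise_empty]
      change (Matrix.of fun i j => fderiv ℝ (a i) x (e j)).det + _ -
        (Matrix.of fun i j => fderiv ℝ (a i) x (e j)).det = _
      rw [add_sub_cancel_left]
      refine Finset.sum_congr rfl fun t _ => ?_
      have hpw : t.piecewise (fun i j => fderiv ℝ (c i) x (e j))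
          (fun i j => fderiv ℝ (a i) x (e j)) =
          fun i j => fderiv ℝ (t.piecewise c a i) x (e j) := by
        funext i j
        by_cases hi : i ∈ t <;> simp [hi]
      rw [hpw]
      rfl
    simp only [hdiff]
    have hz : ∀ t ∈ Finset.univ.erase (∅ : Finset s),
        Integrable (fun x => (Matrix.of fun i j => fderiv ℝ (t.piecewise c a i) x (e j)).det) ∧
        ∫ x, (Matrix.of fun i j => fderiv ℝ (t.piecewise c a i) x (e j)).det = 0 := fun t ht => by
      obtain ⟨i₀, hi₀⟩ := Finset.nonempty_iff_ne_empty.2 (Finset.ne_of_mem_erase ht)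
      refine integral_det_fderiv_eq_zero e (t.piecewise c a) (fun i => ?_) i₀ ?_
      · simp only [Finset.piecewise]
        split_ifs
        exacts [hc i, ha i]
      · rw [Finset.piecewise_eq_of_mem _ _ _ hi₀]
        exact hcs i₀
    refine ⟨integrable_finsetSum _ fun t ht => (hz t ht).1, ?_⟩
    rw [integral_finsetSum _ fun t ht => (hz t ht).1]
    exact Finset.sum_eq_zero fun t ht => (hz t ht).2
  simp only [sumMinors, ← Finset.sum_sub_distrib]
  rw [integral_finsetSum _ fun s _ => (hs s).1]
  exact Finset.sum_eq_zero fun s _ => (hs s).2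

theorem integrableOn_unitBall {f : E n → ℝ} (hf : Continuous f) :
    IntegrableOn f (unitBall n) :=
  (hf.continuousOn.integrableOn_compact (isCompact_closedBall (0 : E n) 1)).mono_set
    Metric.ball_subset_closedBall

theorem jacobian_congr {V W : E n → E n} {x : E n} (h : V =ᶠ[𝓝 x] W) :
    jacobian V x = jacobian W x := by
  ext i j
  simp only [jacobian, Matrix.of_apply, partialDeriv]
  rw [Filter.EventuallyEq.fderiv_eq]
  exact h.fun_comp fun z : E n => z i

/-- The integral of the sum of the principal minors of the Jacobian matrix depends only on the
boundary values. -/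
theorem setIntegral_sumMinors_jacobian_eq {V W : E n → E n} (hV : ContDiff ℝ ∞ V)
    (hW : ContDiff ℝ ∞ W) (hVW : HasCompactSupport fun x => W x - V x)
    (hsupp : tsupport (fun x => W x - V x) ⊆ unitBall n) (k : ℕ) :
    ∫ x in unitBall n, sumMinors k (jacobian W x) =
      ∫ x in unitBall n, sumMinors k (jacobian V x) := by
  rw [← sub_eq_zero, ← integral_sub (integrableOn_unitBall (continuous_sumMinors_jacobian hW k))
    (integrableOn_unitBall (continuous_sumMinors_jacobian hV k)),
    ← integral_sumMinors_jacobian_sub hV hW hVW k]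
  refine setIntegral_eq_integral_of_forall_compl_eq_zero fun x hx => ?_
  have h : (fun x => W x - V x) =ᶠ[𝓝 x] 0 :=
    notMem_tsupport_iff_eventuallyEq.1 fun h => hx (hsupp h)
  rw [jacobian_congr (V := W) (W := V), sub_self]
  filter_upwards [h] with y hy
  exact sub_eq_zero.1 hy

end NullLagrangian

/-! ### Products, minors and dominated limits in `L^p` -/

section LpConvergence

variable {α : Type*} [MeasurableSpace α] {μ : Measure α}

/-- Hölder's inequality applied to each term of `fg - FG = (f-F)(g-G) + (f-F)G + F(g-G)`; `1 ≤ r`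
provides the triangle inequality. -/
theorem tendsto_eLpNorm_mul {p q r : ℝ≥0∞} [ENNReal.HolderTriple p q r] (hr : 1 ≤ r)
    {f : ℕ → α → ℝ} {F : α → ℝ} {g : ℕ → α → ℝ} {G : α → ℝ}
    (hf : ∀ k, MemLp (f k) p μ) (hF : MemLp F p μ) (hg : ∀ k, MemLp (g k) q μ) (hG : MemLp G q μ)
    (hfF : Tendsto (fun k => eLpNorm (fun x => f k x - F x) p μ) atTop (𝓝 0))
    (hgG : Tendsto (fun k => eLpNorm (fun x => g k x - G x) q μ) atTop (𝓝 0)) :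
    Tendsto (fun k => eLpNorm (fun x => f k x * g k x - F x * G x) r μ) atTop (𝓝 0) := by
  have hfm : ∀ k, AEStronglyMeasurable (fun x => f k x - F x) μ := fun k => (hf k).1.sub hF.1
  have hgm : ∀ k, AEStronglyMeasurable (fun x => g k x - G x) μ := fun k => (hg k).1.sub hG.1
  have hlim : Tendsto (fun k =>
      eLpNorm (fun x => f k x - F x) p μ * eLpNorm (fun x => g k x - G x) q μ +
      eLpNorm (fun x => f k x - F x) p μ * eLpNorm G q μ +
      eLpNorm F p μ * eLpNorm (fun x => g k x - G x) q μ) atTop (𝓝 0) := by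
    have h1 := ENNReal.Tendsto.mul hfF (Or.inr ENNReal.zero_ne_top) hgG
      (Or.inr ENNReal.zero_ne_top)
    have h2 := ENNReal.Tendsto.mul_const hfF (Or.inr hG.2.ne)
    have h3 := ENNReal.Tendsto.const_mul hgG (Or.inr hF.2.ne)
    simpa using (h1.add h2).add h3
  refine tendsto_of_tendsto_of_tendsto_of_le_of_le tendsto_const_nhds hlim (fun _ => zero_le)
    fun k => ?_
  have heq : (fun x => f k x * g k x - F x * G x) =
      ((fun x => f k x - F x) • (fun x => g k x - G x) + (fun x => f k x - F x) • G) +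
        F • (fun x => g k x - G x) := by
    funext x
    simp only [Pi.add_apply, Pi.mul_apply, smul_eq_mul]
    ring
  simp only [heq]
  refine (eLpNorm_add_le (((hfm k).smul (hgm k)).add ((hfm k).smul hG.1)) (hF.1.smul (hgm k))
    hr).trans ?_
  gcongr
  · refine (eLpNorm_add_le ((hfm k).smul (hgm k)) ((hfm k).smul hG.1) hr).trans ?_
    gcongr
    · exact eLpNorm_smul_le_mul_eLpNorm (hgm k) (hfm k)
    · exact eLpNorm_smul_le_mul_eLpNorm hG.1 (hfm k)
  · exact eLpNorm_smul_le_mul_eLpNorm (hgm k) hF.1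

theorem holderTriple_div_natCast {p : ℝ≥0∞} (hp : p ≠ 0) (hp' : p ≠ ⊤) {m : ℕ} :
    ENNReal.HolderTriple p (p / m) (p / (m + 1 : ℕ)) := by
  constructor
  rw [ENNReal.inv_div (Or.inr hp') (Or.inr hp), ENNReal.inv_div (Or.inr hp') (Or.inr hp),
    ← one_div, ENNReal.div_add_div_same, Nat.cast_add, Nat.cast_one, add_comm]

/-- Induction on the number of factors through Hölder's inequality. With exactly `p` factors the
exponent is one, which is the case needed for minors of order `p`. -/
theorem tendsto_eLpNorm_prod {ι : Type*} [DecidableEq ι] {p : ℝ≥0∞} (hp' : p ≠ ⊤)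
    {f : ℕ → ι → α → ℝ} {F : ι → α → ℝ} (hf : ∀ k i, MemLp (f k i) p μ) (hF : ∀ i, MemLp (F i) p μ)
    (hfF : ∀ i, Tendsto (fun k => eLpNorm (fun x => f k i x - F i x) p μ) atTop (𝓝 0))
    (s : Finset ι) (hs : s.Nonempty) (hsp : (s.card : ℝ≥0∞) ≤ p) :
    (∀ k, MemLp (fun x => ∏ i ∈ s, f k i x) (p / s.card) μ) ∧
    MemLp (fun x => ∏ i ∈ s, F i x) (p / s.card) μ ∧
    Tendsto (fun k => eLpNorm (fun x => ∏ i ∈ s, f k i x - ∏ i ∈ s, F i x) (p / s.card) μ)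
      atTop (𝓝 0) := by
  induction hs using Finset.Nonempty.cons_induction with
  | singleton i => simpa using ⟨fun k => hf k i, hF i, hfF i⟩
  | cons i s his hs ih =>
    have hp : p ≠ 0 := by
      rintro rfl
      simp at hsp
    have hle : (s.card : ℝ≥0∞) ≤ p := le_trans (by rw [Finset.card_cons]; exact_mod_cast Nat.le_succ _) hsp
    obtain ⟨h1, h2, h3⟩ := ih hle
    simp only [Finset.prod_cons, Finset.card_cons] at hsp ⊢
    have := holderTriple_div_natCast hp hp' (m := s.card)
    have hr : 1 ≤ p / ((s.card + 1 : ℕ) : ℝ≥0∞) := by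
      rw [ENNReal.le_div_iff_mul_le (Or.inl (by simp)) (Or.inl (ENNReal.natCast_ne_top _)), one_mul]
      exact hsp
    exact ⟨fun k => (h1 k).mul' (hf k i), h2.mul' (hF i),
      tendsto_eLpNorm_mul hr (fun k => hf k i) (hF i) h1 h2 (hfF i) h3⟩

/-- Dominated convergence for `|f k - F|^p`, with majorant `(2g)^p`. -/
theorem tendsto_eLpNorm_of_dominated {p : ℝ≥0∞} (hp : p ≠ 0) (hp' : p ≠ ⊤) {f : ℕ → α → ℝ}
    {F g : α → ℝ} (hf : ∀ k, AEStronglyMeasurable (f k) μ) (hg : MemLp g p μ)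
    (hb : ∀ k, ∀ᵐ x ∂μ, |f k x| ≤ g x)
    (hlim : ∀ᵐ x ∂μ, Tendsto (fun k => f k x) atTop (𝓝 (F x))) :
    MemLp F p μ ∧ Tendsto (fun k => eLpNorm (fun x => f k x - F x) p μ) atTop (𝓝 0) := by
  have hFm : AEStronglyMeasurable F μ := aestronglyMeasurable_of_tendsto_ae _ hf hlim
  have hFb : ∀ᵐ x ∂μ, |F x| ≤ g x := by
    filter_upwards [hlim, ae_all_iff.2 hb] with x hx hbx
    exact le_of_tendsto hx.abs (Eventually.of_forall hbx)
  refine ⟨hg.mono' hFm hFb, ?_⟩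
  have hp0 : 0 < p.toReal := ENNReal.toReal_pos hp hp'
  simp only [eLpNorm_eq_lintegral_rpow_enorm_toReal hp hp']
  have hdom : ∫⁻ x, ‖2 * g x‖ₑ ^ p.toReal ∂μ ≠ ⊤ := by
    have := (hg.const_mul 2).2
    rw [eLpNorm_eq_lintegral_rpow_enorm_toReal hp hp'] at this
    exact ((ENNReal.rpow_lt_top_iff_of_pos (by positivity)).1 this).ne
  have key : Tendsto (fun k => ∫⁻ x, ‖f k x - F x‖ₑ ^ p.toReal ∂μ) atTop (𝓝 (∫⁻ _, 0 ∂μ)) := by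
    refine tendsto_lintegral_of_dominated_convergence' (fun x => ‖2 * g x‖ₑ ^ p.toReal)
      (fun k => ((hf k).sub hFm).enorm.pow_const _) (fun k => ?_) hdom ?_
    · filter_upwards [hb k, hFb] with x h1 h2
      have h3 : ‖f k x - F x‖ ≤ ‖2 * g x‖ := by
        simp only [Real.norm_eq_abs]
        refine (abs_sub _ _).trans (le_trans ?_ (le_abs_self _))
        linarith
      exact ENNReal.rpow_le_rpow (enorm_le_iff_norm_le.2 h3) hp0.le
    · filter_upwards [hlim] with x hx
      have h1 : Tendsto (fun k => ‖f k x - F x‖ₑ) atTop (𝓝 0) := by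
        have := (hx.sub_const (F x)).enorm
        simpa using this
      have := (ENNReal.continuous_rpow_const (y := p.toReal)).tendsto 0 |>.comp h1
      rwa [ENNReal.zero_rpow_of_pos hp0] at this
  rw [lintegral_zero] at key
  have h2 := (ENNReal.continuous_rpow_const (y := 1 / p.toReal)).tendsto 0 |>.comp key
  rwa [ENNReal.zero_rpow_of_pos (by positivity)] at h2

theorem tendsto_eLpNorm_bounded_mul {p : ℝ≥0∞} {f : ℕ → α → ℝ} {F b : α → ℝ} {C : ℝ}
    (hb : ∀ᵐ x ∂μ, |b x| ≤ C)
    (hfF : Tendsto (fun k => eLpNorm (fun x => f k x - F x) p μ) atTop (𝓝 0)) :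
    Tendsto (fun k => eLpNorm (fun x => b x * f k x - b x * F x) p μ) atTop (𝓝 0) := by
  have hlim : Tendsto (fun k => ENNReal.ofReal C * eLpNorm (fun x => f k x - F x) p μ)
      atTop (𝓝 0) := by
    simpa using ENNReal.Tendsto.const_mul hfF (Or.inr ENNReal.ofReal_ne_top)
  refine tendsto_of_tendsto_of_tendsto_of_le_of_le tendsto_const_nhds hlim (fun _ => zero_le)
    fun k => ?_
  refine eLpNorm_le_mul_eLpNorm_of_ae_le_mul ?_ _
  filter_upwards [hb] with x hx
  rw [← mul_sub, norm_mul]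
  exact mul_le_mul_of_nonneg_right hx (norm_nonneg _)

theorem tendsto_eLpNorm_add {p : ℝ≥0∞} (hp : 1 ≤ p) {f g : ℕ → α → ℝ} {F G : α → ℝ}
    (hf : ∀ k, AEStronglyMeasurable (f k) μ) (hF : AEStronglyMeasurable F μ)
    (hg : ∀ k, AEStronglyMeasurable (g k) μ) (hG : AEStronglyMeasurable G μ)
    (hfF : Tendsto (fun k => eLpNorm (fun x => f k x - F x) p μ) atTop (𝓝 0))
    (hgG : Tendsto (fun k => eLpNorm (fun x => g k x - G x) p μ) atTop (𝓝 0)) :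
    Tendsto (fun k => eLpNorm (fun x => f k x + g k x - (F x + G x)) p μ) atTop (𝓝 0) := by
  refine tendsto_of_tendsto_of_tendsto_of_le_of_le tendsto_const_nhds
    (by simpa using hfF.add hgG) (fun _ => zero_le) fun k => ?_
  have heq : (fun x => f k x + g k x - (F x + G x)) =
      (fun x => f k x - F x) + (fun x => g k x - G x) := by
    funext x
    simp only [Pi.add_apply]
    ring
  rw [heq]
  exact eLpNorm_add_le ((hf k).sub hF) ((hg k).sub hG) hp

theorem tendsto_eLpNorm_one_of_tendsto_eLpNorm [IsFiniteMeasure μ] {p : ℝ≥0∞} (hp : 1 ≤ p)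
    {f : ℕ → α → ℝ} {F : α → ℝ} (hf : ∀ k, AEStronglyMeasurable (f k) μ)
    (hF : AEStronglyMeasurable F μ)
    (hfF : Tendsto (fun k => eLpNorm (fun x => f k x - F x) p μ) atTop (𝓝 0)) :
    Tendsto (fun k => eLpNorm (fun x => f k x - F x) 1 μ) atTop (𝓝 0) := by
  have hc : μ Set.univ ^ (1 / (1 : ℝ≥0∞).toReal - 1 / p.toReal) ≠ ⊤ := by
    refine ENNReal.rpow_ne_top_of_nonneg ?_ (measure_ne_top _ _)
    rcases eq_or_ne p ⊤ with rfl | hpt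
    · simp
    have : 1 ≤ p.toReal := by
      rw [← ENNReal.toReal_one]
      exact (ENNReal.toReal_le_toReal ENNReal.one_ne_top hpt).2 hp
    rw [ENNReal.toReal_one, sub_nonneg]
    exact one_div_le_one_div_of_le one_pos this
  have hlim := ENNReal.Tendsto.mul_const hfF (Or.inr hc)
  rw [zero_mul] at hlim
  exact tendsto_of_tendsto_of_tendsto_of_le_of_le tendsto_const_nhds hlim (fun _ => zero_le)
    fun k => eLpNorm_le_eLpNorm_mul_rpow_measure_univ hp ((hf k).sub hF)

open Matrix in
/-- The sum of the principal minors of order `p` is continuous from `L^p` to `L^1`. -/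
theorem tendsto_integral_sumMinors {n p : ℕ} (hp : 1 ≤ p)
    {M : ℕ → α → Matrix (Fin n) (Fin n) ℝ} {N : α → Matrix (Fin n) (Fin n) ℝ}
    (hM : ∀ k i j, MemLp (fun x => M k x i j) p μ) (hN : ∀ i j, MemLp (fun x => N x i j) p μ)
    (hMN : ∀ i j, Tendsto (fun k => eLpNorm (fun x => M k x i j - N x i j) p μ) atTop (𝓝 0)) :
    Integrable (fun x => sumMinors p (N x)) μ ∧
    Tendsto (fun k => ∫ x, sumMinors p (M k x) ∂μ) atTop (𝓝 (∫ x, sumMinors p (N x) ∂μ)) := by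
  have hp0 : (p : ℝ≥0∞) ≠ 0 := by
    simp only [ne_eq, Nat.cast_eq_zero]
    omega
  have hexp : ∀ A : Matrix (Fin n) (Fin n) ℝ, sumMinors p A =
      ∑ s ∈ (Finset.univ : Finset (Fin n)).powersetCard p, ∑ σ : Equiv.Perm s, ((σ.sign : ℤ) : ℝ) *
        ∏ i : s, A ((σ i : s) : Fin n) (i : Fin n) := by
    intro A
    simp only [sumMinors, det_apply', submatrix_apply]
  have key : ∀ s ∈ (Finset.univ : Finset (Fin n)).powersetCard p, ∀ σ : Equiv.Perm s,
      (∀ k, Integrable (fun x => ∏ i : s, M k x ((σ i : s) : Fin n) (i : Fin n)) μ) ∧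
      Integrable (fun x => ∏ i : s, N x ((σ i : s) : Fin n) (i : Fin n)) μ ∧
      Tendsto (fun k => ∫ x, ∏ i : s, M k x ((σ i : s) : Fin n) (i : Fin n) ∂μ) atTop
        (𝓝 (∫ x, ∏ i : s, N x ((σ i : s) : Fin n) (i : Fin n) ∂μ)) := by
    intro s hs σ
    have hcard : (Finset.univ : Finset s).card = p := by
      simpa using (Finset.mem_powersetCard.1 hs).2
    have hne : (Finset.univ : Finset s).Nonempty := by
      rw [← Finset.card_pos, hcard]
      omega
    obtain ⟨h1, h2, h3⟩ := tendsto_eLpNorm_prod (μ := μ) (p := (p : ℝ≥0∞))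
      (ENNReal.natCast_ne_top p) (f := fun k (i : s) x => M k x (σ i) i)
      (F := fun (i : s) x => N x (σ i) i)
      (fun k i => hM k _ _) (fun i => hN _ _) (fun i => hMN _ _) Finset.univ hne (by rw [hcard])
    rw [hcard, ENNReal.div_self hp0 (ENNReal.natCast_ne_top p)] at h1 h2 h3
    have h1' := fun k => memLp_one_iff_integrable.1 (h1 k)
    exact ⟨h1', memLp_one_iff_integrable.1 h2,
      tendsto_integral_of_L1' _ h2.1 (Eventually.of_forall h1') h3⟩
  have hiM : ∀ k, ∀ s ∈ (Finset.univ : Finset (Fin n)).powersetCard p, ∀ σ : Equiv.Perm s,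
      Integrable (fun x => ((σ.sign : ℤ) : ℝ) * ∏ i : s, M k x ((σ i : s) : Fin n) (i : Fin n)) μ := fun k s hs σ =>
    ((key s hs σ).1 k).const_mul _
  have hiN : ∀ s ∈ (Finset.univ : Finset (Fin n)).powersetCard p, ∀ σ : Equiv.Perm s,
      Integrable (fun x => ((σ.sign : ℤ) : ℝ) * ∏ i : s, N x ((σ i : s) : Fin n) (i : Fin n)) μ := fun s hs σ =>
    (key s hs σ).2.1.const_mul _
  simp only [hexp]
  refine ⟨integrable_finsetSum _ fun s hs => integrable_finsetSum _ fun σ _ => hiN s hs σ, ?_⟩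
  rw [integral_finsetSum _ fun s hs => integrable_finsetSum _ fun σ _ => hiN s hs σ]
  simp_rw [fun k => integral_finsetSum (μ := μ) ((Finset.univ : Finset (Fin n)).powersetCard p)
    fun s hs => integrable_finsetSum (Finset.univ : Finset (Equiv.Perm s)) fun σ _ => hiM k s hs σ]
  refine tendsto_finsetSum _ fun s hs => ?_
  rw [integral_finsetSum _ fun σ _ => hiN s hs σ]
  simp_rw [fun k => integral_finsetSum (μ := μ) (Finset.univ : Finset (Equiv.Perm s))
    fun σ _ => hiM k s hs σ, integral_const_mul]
  exact tendsto_finsetSum _ fun σ _ => (key s hs σ).2.2.const_mul _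

end LpConvergence

/-! ### Weak derivatives on the ball and approximation by smooth maps -/

section WeakDerivatives

variable {n : ℕ}

/-- Lebesgue measure on the unit ball. -/
noncomputable abbrev ballMeasure (n : ℕ) : Measure (E n) := volume.restrict (unitBall n)

instance isFiniteMeasure_ballMeasure : IsFiniteMeasure (ballMeasure n) :=
  ⟨by simpa [unitBall] using measure_ball_lt_top⟩

theorem isOpen_unitBall : IsOpen (unitBall n) := Metric.isOpen_ball

theorem exists_bound_unitBall {f : E n → ℝ} (hf : Continuous f) :
    ∃ C, ∀ᵐ x ∂ballMeasure n, |f x| ≤ C := by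
  obtain ⟨C, hC⟩ := (isCompact_closedBall (0 : E n) 1).exists_bound_of_continuousOn hf.continuousOn
  refine ⟨C, ae_restrict_of_forall_mem isOpen_unitBall.measurableSet fun x hx => ?_⟩
  exact hC x (Metric.ball_subset_closedBall hx)

theorem memLp_ballMeasure {f : E n → ℝ} (hf : Continuous f) (p : ℝ≥0∞) :
    MemLp f p (ballMeasure n) := by
  obtain ⟨C, hC⟩ := exists_bound_unitBall hf
  exact MemLp.of_bound hf.aestronglyMeasurable C hC

theorem setIntegral_unitBall_eq {f φ : E n → ℝ} (h : tsupport φ ⊆ unitBall n) :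
    ∫ x in unitBall n, f x * φ x = ∫ x, f x * φ x := by
  refine setIntegral_eq_integral_of_forall_compl_eq_zero fun x hx => ?_
  rw [image_eq_zero_of_notMem_tsupport fun h' => hx (h h'), mul_zero]

theorem tsupport_partialDeriv_subset (j : Fin n) (φ : E n → ℝ) :
    tsupport (partialDeriv j φ) ⊆ tsupport φ :=
  (closure_mono fun x hx => by
    contrapose! hx
    simp only [Function.mem_support, ne_eq, not_not] at hx ⊢
    simp [partialDeriv, hx]).trans (tsupport_fderiv_subset ℝ (f := φ))

/-- Fundamental lemma of the calculus of variations. It is what allows the chosen representative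
`weakJacobian` to be replaced by an explicit matrix. -/
theorem HasWeakPartial.ae_eq {j : Fin n} {f g₁ g₂ : E n → ℝ}
    (h₁ : HasWeakPartial (unitBall n) j f g₁) (h₂ : HasWeakPartial (unitBall n) j f g₂) :
    g₁ =ᵐ[ballMeasure n] g₂ := by
  have h := isOpen_unitBall.ae_eq_zero_of_integral_contDiff_smul_eq_zero
    (h₁.2.1.sub h₂.2.1) (μ := volume) fun φ hφ hc hs => ?_
  · rw [Filter.EventuallyEq, ae_restrict_iff' isOpen_unitBall.measurableSet]
    filter_upwards [h] with x hx hxU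
    exact sub_eq_zero.1 (hx hxU)
  · have hi : ∀ g : E n → ℝ, LocallyIntegrableOn g (unitBall n) →
        Integrable fun x => g x * φ x := by
      intro g hg
      have h1 : IntegrableOn (fun x => g x * φ x) (tsupport φ) :=
        ((hg.integrableOn_compact_subset hs hc).mul_continuousOn hφ.continuous.continuousOn hc)
      refine (integrableOn_iff_integrable_of_support_subset ?_).1 h1
      exact (Function.support_mul_subset_right _ _).trans (subset_tsupport φ)
    have e1 := h₁.2.2 φ hφ hc hs
    have e2 := h₂.2.2 φ hφ hc hs
    rw [e1, neg_inj, setIntegral_unitBall_eq hs, setIntegral_unitBall_eq hs] at e2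
    simp only [Pi.sub_apply, smul_eq_mul, mul_comm (φ _), sub_mul]
    rw [integral_sub (hi _ h₁.2.1) (hi _ h₂.2.1), e2, sub_self]

theorem tendsto_integral_mul_bounded {f : ℕ → E n → ℝ} {F b : E n → ℝ}
    (hb : Continuous b) (hf : ∀ k, Integrable (f k) (ballMeasure n))
    (hF : Integrable F (ballMeasure n))
    (hfF : Tendsto (fun k => eLpNorm (fun x => f k x - F x) 1 (ballMeasure n)) atTop (𝓝 0)) :
    Tendsto (fun k => ∫ x in unitBall n, f k x * b x) atTop (𝓝 (∫ x in unitBall n, F x * b x)) := by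
  obtain ⟨C, hC⟩ := exists_bound_unitBall hb
  have h := tendsto_eLpNorm_bounded_mul hC hfF
  simp only [mul_comm _ (b _)]
  refine tendsto_integral_of_L1' _ (hb.aestronglyMeasurable.mul hF.1)
    (Eventually.of_forall fun k => ?_) h
  exact (hf k).bdd_mul hb.aestronglyMeasurable hC

theorem integral_unitBall_mul_partialDeriv {f φ : E n → ℝ} (hf : ContDiff ℝ ∞ f)
    (hφ : ContDiff ℝ ∞ φ) (hc : HasCompactSupport φ) (hs : tsupport φ ⊆ unitBall n) (j : Fin n) :
    ∫ x in unitBall n, f x * partialDeriv j φ x = - ∫ x in unitBall n, partialDeriv j f x * φ x := by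
  rw [setIntegral_unitBall_eq ((tsupport_partialDeriv_subset j φ).trans hs),
    setIntegral_unitBall_eq hs]
  refine integral_mul_fderiv_eq_neg_fderiv_mul_of_integrable ?_ ?_ ?_ ?_ ?_
  · exact ((contDiff_fderiv_apply hf _).continuous.mul
      hφ.continuous).integrable_of_hasCompactSupport hc.mul_left
  · exact (hf.continuous.mul (contDiff_fderiv_apply hφ _).continuous).integrable_of_hasCompactSupport
      (hasCompactSupport_fderiv_apply hc _).mul_left
  · exact (hf.continuous.mul hφ.continuous).integrable_of_hasCompactSupport hc.mul_left
  · exact fun x _ => hf.differentiable (by simp) x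
  · exact fun x _ => hφ.differentiable (by simp) x

/-- An `L¹` limit of smooth functions whose derivatives converge in `L¹` has a weak derivative. -/
theorem hasWeakPartial_of_tendsto {j : Fin n} {f : ℕ → E n → ℝ} {F G : E n → ℝ}
    (hf : ∀ k, ContDiff ℝ ∞ (f k)) (hF : Integrable F (ballMeasure n))
    (hG : Integrable G (ballMeasure n))
    (hfF : Tendsto (fun k => eLpNorm (fun x => f k x - F x) 1 (ballMeasure n)) atTop (𝓝 0))
    (hfG : Tendsto (fun k => eLpNorm (fun x => partialDeriv j (f k) x - G x) 1 (ballMeasure n))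
      atTop (𝓝 0)) :
    HasWeakPartial (unitBall n) j F G := by
  refine ⟨IntegrableOn.locallyIntegrableOn hF, IntegrableOn.locallyIntegrableOn hG,
    fun φ hφ hc hs => ?_⟩
  have h1 := tendsto_integral_mul_bounded (b := partialDeriv j φ)
    (contDiff_fderiv_apply hφ _).continuous (fun k => integrableOn_unitBall (hf k).continuous) hF hfF
  have h2 := (tendsto_integral_mul_bounded hφ.continuous (fun k =>
    integrableOn_unitBall (contDiff_fderiv_apply (hf k) _).continuous) hG hfG).neg
  refine tendsto_nhds_unique h1 (h2.congr fun k => ?_)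
  exact (integral_unitBall_mul_partialDeriv (hf k) hφ hc hs j).symm

/-- Maps with values in the sphere which are limits in `W^{1,p}` of smooth maps that agree with the
identity near the boundary, together with their weak Jacobian matrix. -/
structure AdmissiblePair (p : ℝ≥0∞) (u : E n → E n) (A : E n → Matrix (Fin n) (Fin n) ℝ) :
    Prop where
  memLp : MemLp u p (ballMeasure n)
  memLp_jac : ∀ i j, MemLp (fun x => A x i j) p (ballMeasure n)
  norm_eq : ∀ᵐ x ∂ballMeasure n, ‖u x‖ = 1
  approx : ∃ v : ℕ → E n → E n, (∀ k, ContDiff ℝ ∞ (v k) ∧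
    HasCompactSupport (fun x => v k x - x) ∧ tsupport (fun x => v k x - x) ⊆ unitBall n) ∧
    Tendsto (fun k => eLpNorm (fun x => v k x - u x) p (ballMeasure n)) atTop (𝓝 0) ∧
    ∀ i j, Tendsto (fun k => eLpNorm (fun x => jacobian (v k) x i j - A x i j) p (ballMeasure n))
      atTop (𝓝 0)

theorem tendsto_eLpNorm_coord {p : ℝ≥0∞} {f : ℕ → E n → E n} {F : E n → E n}
    (h : Tendsto (fun k => eLpNorm (fun x => f k x - F x) p (ballMeasure n)) atTop (𝓝 0))
    (i : Fin n) :
    Tendsto (fun k => eLpNorm (fun x => f k x i - F x i) p (ballMeasure n)) atTop (𝓝 0) :=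
  tendsto_of_tendsto_of_tendsto_of_le_of_le tendsto_const_nhds h (fun _ => zero_le)
    fun k => eLpNorm_mono fun x => PiLp.norm_apply_le (f k x - F x) i

theorem tendsto_eLpNorm_of_coord {p : ℝ≥0∞} (hp : 1 ≤ p) {f : ℕ → E n → E n} {F : E n → E n}
    (hf : ∀ k, AEStronglyMeasurable (f k) (ballMeasure n))
    (hF : AEStronglyMeasurable F (ballMeasure n))
    (h : ∀ i, Tendsto (fun k => eLpNorm (fun x => f k x i - F x i) p (ballMeasure n))
      atTop (𝓝 0)) :
    Tendsto (fun k => eLpNorm (fun x => f k x - F x) p (ballMeasure n)) atTop (𝓝 0) := by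
  have hsum := tendsto_finsetSum Finset.univ fun i _ => h i
  rw [Finset.sum_const_zero] at hsum
  refine tendsto_of_tendsto_of_tendsto_of_le_of_le tendsto_const_nhds hsum (fun _ => zero_le)
    fun k => ?_
  have hm : ∀ i ∈ (Finset.univ : Finset (Fin n)),
      AEStronglyMeasurable (fun x => ‖f k x i - F x i‖) (ballMeasure n) := fun i _ =>
    ((EuclideanSpace.proj (𝕜 := ℝ) i).continuous.comp_aestronglyMeasurable
      ((hf k).sub hF)).norm
  calc eLpNorm (fun x => f k x - F x) p (ballMeasure n)
      ≤ eLpNorm (∑ i, fun x => ‖f k x i - F x i‖) p (ballMeasure n) := by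
        refine eLpNorm_mono_real fun x => ?_
        rw [Finset.sum_apply, EuclideanSpace.norm_eq]
        refine Real.sqrt_le_iff.2 ⟨Finset.sum_nonneg fun _ _ => norm_nonneg _, ?_⟩
        exact Finset.sum_sq_le_sq_sum_of_nonneg fun _ _ => norm_nonneg _
    _ ≤ ∑ i, eLpNorm (fun x => ‖f k x i - F x i‖) p (ballMeasure n) := eLpNorm_sum_le hm hp
    _ = _ := by simp only [eLpNorm_norm]

namespace AdmissiblePair

variable {p : ℝ≥0∞} {u : E n → E n} {A : E n → Matrix (Fin n) (Fin n) ℝ}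

theorem memLp_coord (h : AdmissiblePair p u A) (i : Fin n) :
    MemLp (fun x => u x i) p (ballMeasure n) :=
  h.memLp.eval_piLp i

/-- The ball has finite measure, so `L^p` convergence implies `L^1` convergence, which suffices for
identifying weak derivatives. -/
theorem mono (h : AdmissiblePair p u A) (hp : 1 ≤ p) : AdmissiblePair 1 u A := by
  obtain ⟨v, hv, hvu, hvA⟩ := h.approx
  have hu1 : MemLp u 1 (ballMeasure n) := h.memLp.mono_exponent hp
  refine ⟨hu1, fun i j => (h.memLp_jac i j).mono_exponent hp, h.norm_eq, v, hv, ?_, ?_⟩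
  · refine tendsto_eLpNorm_of_coord le_rfl (fun k => (hv k).1.continuous.aestronglyMeasurable)
      h.memLp.1 fun i => tendsto_eLpNorm_one_of_tendsto_eLpNorm hp
        (fun k => (contDiff_coord (hv k).1 i).continuous.aestronglyMeasurable)
        (h.memLp_coord i).1 (tendsto_eLpNorm_coord hvu i)
  · exact fun i j => tendsto_eLpNorm_one_of_tendsto_eLpNorm hp
      (fun k => (continuous_jacobian (hv k).1 i j).aestronglyMeasurable) (h.memLp_jac i j).1
      (hvA i j)

theorem isWeakJacobian (h : AdmissiblePair p u A) (hp : 1 ≤ p) :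
    IsWeakJacobian (unitBall n) u A := by
  have h := h.mono hp
  obtain ⟨v, hv, hvu, hvA⟩ := h.approx
  exact fun i j => hasWeakPartial_of_tendsto (fun k => contDiff_coord (hv k).1 i)
    (memLp_one_iff_integrable.1 (h.memLp_coord i)) (memLp_one_iff_integrable.1 (h.memLp_jac i j))
    (tendsto_eLpNorm_coord hvu i) (hvA i j)

end AdmissiblePair

theorem isWeakJacobian_weakJacobian {Ω : Set (E n)} {u : E n → E n}
    (h : ∃ G, IsWeakJacobian Ω u G) : IsWeakJacobian Ω u (weakJacobian Ω u) := by
  rw [weakJacobian, dif_pos h]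
  exact h.choose_spec

theorem IsWeakJacobian.weakJacobian_ae_eq {u : E n → E n} {A : E n → Matrix (Fin n) (Fin n) ℝ}
    (h : IsWeakJacobian (unitBall n) u A) :
    weakJacobian (unitBall n) u =ᵐ[ballMeasure n] A := by
  have h' := isWeakJacobian_weakJacobian ⟨A, h⟩
  have : ∀ i j, ∀ᵐ x ∂ballMeasure n, weakJacobian (unitBall n) u x i j = A x i j := fun i j =>
    (h' i j).ae_eq (h i j)
  filter_upwards [ae_all_iff.2 fun i => ae_all_iff.2 (this i)] with x hx
  ext i j
  exact hx i j

theorem jacobian_id (x : E n) : jacobian (fun y : E n => y) x = 1 := by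
  ext i j
  have : (fun y : E n => y i) = EuclideanSpace.proj (𝕜 := ℝ) i := rfl
  rw [jacobian, Matrix.of_apply, partialDeriv, this, ContinuousLinearMap.fderiv]
  simp [Matrix.one_apply]

theorem jacobian_add {V W : E n → E n} (hV : ContDiff ℝ ∞ V) (hW : ContDiff ℝ ∞ W) (x : E n) :
    jacobian (fun y => V y + W y) x = jacobian V x + jacobian W x := by
  ext i j
  simp only [jacobian, Matrix.of_apply, Matrix.add_apply, partialDeriv, PiLp.add_apply]
  rw [fderiv_fun_add ((contDiff_coord hV i).differentiable (by simp) x)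
    ((contDiff_coord hW i).differentiable (by simp) x)]
  rfl

theorem memLp_id (p : ℝ≥0∞) : MemLp (fun x : E n => x) p (ballMeasure n) :=
  MemLp.of_eval_piLp fun i => memLp_ballMeasure (EuclideanSpace.proj (𝕜 := ℝ) i).continuous p

/-- If the test maps `φ k` approximate `u - id`, then `id + φ k` approximates `u`. The limit of the
Jacobians is `1` plus the weak Jacobian of `u - id`, which equals that of `u` by uniqueness. -/
theorem Admissible.admissiblePair {p : ℝ≥0∞} (hp : 1 ≤ p) {u : E n → E n}
    (h : Admissible n p u) : AdmissiblePair p u (weakJacobian (unitBall n) u) := by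
  obtain ⟨⟨hu, hex, hA⟩, hnorm, ⟨hw, hwex, hB⟩, φ, hφ, hφw, hφB⟩ := h
  generalize weakJacobian (unitBall n) (fun x => u x - x) = B at hB hφB
  have hid : ContDiff ℝ ∞ fun x : E n => x := contDiff_id
  have hpair : AdmissiblePair p u fun x => 1 + B x := by
    refine ⟨hu, fun i j => ?_, hnorm, fun k x => x + φ k x, fun k => ⟨?_, ?_, ?_⟩, ?_, fun i j => ?_⟩
    · exact (memLp_const ((1 : Matrix (Fin n) (Fin n) ℝ) i j)).add (hB i j)
    · exact hid.add (hφ k).1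
    · simpa using (hφ k).2.1
    · simpa using (hφ k).2.2
    · refine hφw.congr fun k => ?_
      congr 1
      funext x
      change φ k x - (u x - x) = x + φ k x - u x
      module
    · refine (hφB i j).congr fun k => ?_
      congr 1
      funext x
      rw [jacobian_add hid (hφ k).1, jacobian_id, Matrix.add_apply, Matrix.add_apply,
        add_sub_add_left_eq_sub]
      rfl
  have hae := (hpair.isWeakJacobian hp).weakJacobian_ae_eq
  refine ⟨hu, hA, hnorm, ?_⟩
  obtain ⟨v, hv, hvu, hvA⟩ := hpair.approx
  refine ⟨v, hv, hvu, fun i j => (hvA i j).congr fun k => eLpNorm_congr_ae ?_⟩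
  filter_upwards [hae] with x hx
  rw [hx]

/-- Converse passage, with test maps `v k - id`; it serves to show that `x / ‖x‖` is admissible. -/
theorem AdmissiblePair.admissible {p : ℝ≥0∞} (hp : 1 ≤ p) {u : E n → E n}
    {A : E n → Matrix (Fin n) (Fin n) ℝ} (h : AdmissiblePair p u A) : Admissible n p u := by
  have hJ := h.isWeakJacobian hp
  have hae := hJ.weakJacobian_ae_eq
  have h1 := h.mono hp
  obtain ⟨v, hv, hvu, hvA⟩ := h.approx
  obtain ⟨v', hv', hvu', hvA'⟩ := h1.approx
  have hsm : ∀ k, ContDiff ℝ ∞ fun x => v' k x - x := fun k => (hv' k).1.sub contDiff_id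
  have hsub : ∀ {V : E n → E n}, ContDiff ℝ ∞ V → ∀ x,
      jacobian (fun y => V y - y) x = jacobian V x - 1 := by
    intro V hV x
    have hid : ContDiff ℝ ∞ fun x : E n => x := contDiff_id
    have := jacobian_add (hV.sub hid) hid x
    simp only [sub_add_cancel] at this
    rw [this, jacobian_id, add_sub_cancel_right]
  have hw1 : MemLp (fun x => u x - x) 1 (ballMeasure n) := h1.memLp.sub (memLp_id 1)
  have hJw : IsWeakJacobian (unitBall n) (fun x => u x - x) fun x => A x - 1 := by
    refine fun i j => hasWeakPartial_of_tendsto (fun k => contDiff_coord (hsm k) i)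
      (memLp_one_iff_integrable.1 (hw1.eval_piLp i))
      (memLp_one_iff_integrable.1 ((h1.memLp_jac i j).sub (memLp_const _))) ?_ ?_
    · simpa using tendsto_eLpNorm_coord hvu' i
    · refine (hvA' i j).congr fun k => ?_
      congr 1
      funext x
      change _ = jacobian (fun y => v' k y - y) x i j - _
      rw [hsub (hv' k).1]
      simp
  have haew := hJw.weakJacobian_ae_eq
  refine ⟨⟨h.memLp, ⟨A, hJ⟩, fun i j => (memLp_congr_ae ?_).1 (h.memLp_jac i j)⟩, h.norm_eq,
    ⟨h.memLp.sub (memLp_id p), ⟨_, hJw⟩, fun i j => (memLp_congr_ae ?_).1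
      ((h.memLp_jac i j).sub (memLp_const ((1 : Matrix (Fin n) (Fin n) ℝ) i j)))⟩,
    fun k x => v k x - x, fun k => ⟨(hv k).1.sub contDiff_id, (hv k).2⟩, ?_, fun i j => ?_⟩
  · filter_upwards [hae] with x hx
    rw [hx]
  · filter_upwards [haew] with x hx
    rw [hx]
    rfl
  · simpa using hvu
  · refine (hvA i j).congr fun k => eLpNorm_congr_ae ?_
    filter_upwards [haew] with x hx
    change _ = jacobian (fun y => v k y - y) x i j - _
    rw [hx, hsub (hv k).1]
    simp

end WeakDerivatives

/-! ### Sphere-valued maps: tangency and invariance of weighted minors -/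

section SphereValued

variable {n : ℕ}

theorem tendsto_eLpNorm_sum {α ι : Type*} [MeasurableSpace α] {μ : Measure α} {p : ℝ≥0∞}
    (hp : 1 ≤ p) (s : Finset ι) {f : ℕ → ι → α → ℝ} {F : ι → α → ℝ}
    (hf : ∀ k i, AEStronglyMeasurable (f k i) μ) (hF : ∀ i, AEStronglyMeasurable (F i) μ)
    (hfF : ∀ i, Tendsto (fun k => eLpNorm (fun x => f k i x - F i x) p μ) atTop (𝓝 0)) :
    Tendsto (fun k => eLpNorm (fun x => ∑ i ∈ s, f k i x - ∑ i ∈ s, F i x) p μ) atTop (𝓝 0) := by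
  have hsum := tendsto_finsetSum s fun i _ => hfF i
  rw [Finset.sum_const_zero] at hsum
  refine tendsto_of_tendsto_of_tendsto_of_le_of_le tendsto_const_nhds hsum (fun _ => zero_le)
    fun k => ?_
  have heq : (fun x => ∑ i ∈ s, f k i x - ∑ i ∈ s, F i x) =
      ∑ i ∈ s, fun x => f k i x - F i x := by
    funext x
    rw [Finset.sum_apply, Finset.sum_sub_distrib]
  rw [heq]
  exact eLpNorm_sum_le (fun i _ => (hf k i).sub (hF i)) hp

/-- The denominator `1 + ‖y‖²`, as a polynomial in the coordinates. -/
def oneAddSq (y : E n) : ℝ := 1 + ∑ i, y i ^ 2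

theorem one_le_oneAddSq (y : E n) : 1 ≤ oneAddSq y :=
  le_add_of_nonneg_right (Finset.sum_nonneg fun _ _ => sq_nonneg _)

theorem continuous_oneAddSq : Continuous (oneAddSq (n := n)) := by
  unfold oneAddSq
  fun_prop

/-- The gradient of `1 / (1 + ‖y‖²)`. -/
noncomputable def gradInv (y : E n) (i : Fin n) : ℝ := -(2 * y i) / oneAddSq y ^ 2

/-- From `2 |y i| ≤ 1 + (y i)^2`. The bound does not depend on `y`, so the chain rule survives
limits along approximants that are not uniformly bounded. -/
theorem abs_gradInv_le (y : E n) (i : Fin n) : |gradInv y i| ≤ 1 := by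
  have h1 := one_le_oneAddSq y
  have h2 : 1 + y i ^ 2 ≤ oneAddSq y := by
    have := Finset.single_le_sum (f := fun i => y i ^ 2) (fun _ _ => sq_nonneg _)
      (Finset.mem_univ i)
    simpa [oneAddSq] using this
  rw [gradInv, abs_div, abs_of_nonneg (sq_nonneg (oneAddSq y)), div_le_one (by positivity), abs_le]
  constructor <;> nlinarith [sq_nonneg (y i - 1), sq_nonneg (y i + 1)]

theorem continuous_gradInv (i : Fin n) : Continuous fun y : E n => gradInv y i := by
  unfold gradInv
  refine Continuous.div (by fun_prop) (continuous_oneAddSq.pow 2) fun y => ?_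
  have := one_le_oneAddSq y
  positivity

theorem contDiff_inv_oneAddSq {w : E n → E n} (hw : ContDiff ℝ ∞ w) :
    ContDiff ℝ ∞ fun x => (oneAddSq (w x))⁻¹ := by
  refine ContDiff.inv ?_ fun x => ?_
  · exact contDiff_const.add (ContDiff.sum fun i _ => (contDiff_coord hw i).pow 2)
  · have := one_le_oneAddSq (w x)
    positivity

theorem partialDeriv_inv_oneAddSq {w : E n → E n} (hw : ContDiff ℝ ∞ w) (j : Fin n) (x : E n) :
    partialDeriv j (fun x => (oneAddSq (w x))⁻¹) x =
      ∑ i, gradInv (w x) i * jacobian w x i j := by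
  have h0 : oneAddSq (w x) ≠ 0 := by
    have := one_le_oneAddSq (w x)
    positivity
  have h1 : HasFDerivAt (fun x => oneAddSq (w x))
      (∑ i, (2 * w x i) • fderiv ℝ (fun y => w y i) x) x := by
    have := HasFDerivAt.fun_sum (u := Finset.univ) (x := x) (A := fun i y => w y i ^ 2)
      (A' := fun i => (2 * w x i) • fderiv ℝ (fun y => w y i) x) fun i _ => by
        simpa using ((contDiff_coord hw i).differentiable (by simp) x).hasFDerivAt.pow 2
    exact this.const_add 1
  have h2 := (hasDerivAt_inv h0).comp_hasFDerivAt x h1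
  rw [partialDeriv]
  erw [h2.fderiv]
  simp only [smul_apply, sum_apply, smul_eq_mul,
    Finset.mul_sum]
  refine Finset.sum_congr rfl fun i _ => ?_
  rw [gradInv, jacobian, Matrix.of_apply, partialDeriv]
  field_simp

namespace AdmissiblePair

variable {p : ℝ≥0∞} {u : E n → E n} {A : E n → Matrix (Fin n) (Fin n) ℝ}

/-- The columns of the weak Jacobian matrix of a map to the sphere are tangent to the sphere. -/
theorem tangent (h : AdmissiblePair p u A) (hp : 1 ≤ p) :
    ∀ᵐ x ∂ballMeasure n, ∀ j, ∑ i, u x i * A x i j = 0 := by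
  have h1 := h.mono hp
  obtain ⟨v, hv, hvu, hvA⟩ := h1.approx
  -- Composition with the nonlinear functions below requires almost everywhere convergence, hence a
  -- subsequence.
  obtain ⟨ns, hns, hlim⟩ := (tendstoInMeasure_of_tendsto_eLpNorm one_ne_zero
    (fun k => (hv k).1.continuous.aestronglyMeasurable) h1.memLp.1 hvu).exists_seq_tendsto_ae
  refine ae_all_iff.2 fun j => ?_
  have hAm : ∀ i, AEStronglyMeasurable (fun x => A x i j) (ballMeasure n) := fun i =>
    (h1.memLp_jac i j).1
  have hum := h1.memLp.1
  -- Hence `1 / (1 + ‖u‖²)` is the constant `1/2` and its weak gradient vanishes; the chain rule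
  -- makes that gradient a multiple of `∑ i, u i * A i j`. Using `‖u‖²` directly would require more
  -- than `L^1` control of the approximants.
  have hS : ∀ᵐ x ∂ballMeasure n, oneAddSq (u x) = 2 := by
    filter_upwards [h.norm_eq] with x hx
    have : ‖u x‖ ^ 2 = ∑ i, u x i ^ 2 := by rw [EuclideanSpace.real_norm_sq_eq]
    rw [oneAddSq, ← this, hx]
    norm_num
  have hgm : ∀ i, AEStronglyMeasurable (fun x => gradInv (u x) i * A x i j) (ballMeasure n) :=
    fun i => ((continuous_gradInv i).comp_aestronglyMeasurable hum).mul (hAm i)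
  have hgk : ∀ k i, Continuous fun x => gradInv (v (ns k) x) i := fun k i =>
    (continuous_gradInv i).comp (hv (ns k)).1.continuous
  -- Split as a bounded factor times `∇v - A`, which tends to zero in `L^1`, plus `gradInv (v) * A`,
  -- handled by dominated convergence.
  have hterm : ∀ i, Tendsto (fun k => eLpNorm (fun x =>
      gradInv (v (ns k) x) i * jacobian (v (ns k)) x i j - gradInv (u x) i * A x i j) 1
      (ballMeasure n)) atTop (𝓝 0) := by
    intro i
    have ha : Tendsto (fun k => eLpNorm (fun x => gradInv (v (ns k) x) i *
        (jacobian (v (ns k)) x i j - A x i j) - 0) 1 (ballMeasure n)) atTop (𝓝 0) := by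
      refine tendsto_of_tendsto_of_tendsto_of_le_of_le tendsto_const_nhds
        ((hvA i j).comp hns.tendsto_atTop) (fun _ => zero_le) fun k => eLpNorm_mono fun x => ?_
      rw [sub_zero, norm_mul]
      exact mul_le_of_le_one_left (norm_nonneg _) (abs_gradInv_le _ _)
    have hb := (tendsto_eLpNorm_of_dominated (μ := ballMeasure n) (p := 1) one_ne_zero
      ENNReal.one_ne_top (f := fun k x => gradInv (v (ns k) x) i * A x i j)
      (F := fun x => gradInv (u x) i * A x i j) (g := fun x => |A x i j|)
      (fun k => (hgk k i).aestronglyMeasurable.mul (hAm i)) (h1.memLp_jac i j).abs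
      (fun k => Eventually.of_forall fun x => by
        rw [abs_mul]
        exact mul_le_of_le_one_left (abs_nonneg _) (abs_gradInv_le _ _))
      (by
        filter_upwards [hlim] with x hx
        exact (((continuous_gradInv i).tendsto _).comp hx).mul_const _)).2
    refine (tendsto_eLpNorm_add le_rfl (fun k => (hgk k i).aestronglyMeasurable.mul
      ((continuous_jacobian (hv _).1 i j).aestronglyMeasurable.sub (hAm i)))
      aestronglyMeasurable_const (fun k => (hgk k i).aestronglyMeasurable.mul (hAm i)) (hgm i)
      ha hb).congr fun k => ?_
    congr 1
    funext x
    simp only [Pi.mul_apply, Pi.sub_apply]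
    ring
  have hsum := tendsto_eLpNorm_sum le_rfl Finset.univ
    (fun k i => ((hgk k i).mul (continuous_jacobian (hv (ns k)).1 i j)).aestronglyMeasurable
      (μ := ballMeasure n)) hgm hterm
  have hconst := (tendsto_eLpNorm_of_dominated (μ := ballMeasure n) (p := 1) one_ne_zero
    ENNReal.one_ne_top (f := fun k x => (oneAddSq (v (ns k) x))⁻¹)
    (F := fun _ => (1 / 2 : ℝ)) (g := fun _ => 1)
    (fun k => (contDiff_inv_oneAddSq (hv _).1).continuous.aestronglyMeasurable) (memLp_const 1)
    (fun k => Eventually.of_forall fun x => by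
      have := one_le_oneAddSq (v (ns k) x)
      rw [abs_of_nonneg (by positivity)]
      exact inv_le_one_of_one_le₀ this)
    (by
      filter_upwards [hlim, hS] with x hx hSx
      have h2 := ((continuous_oneAddSq.tendsto _).comp hx).inv₀ (by rw [hSx]; norm_num)
      rw [hSx] at h2
      simpa using h2)).2
  have hw1 := hasWeakPartial_of_tendsto (j := j)
    (fun k => contDiff_inv_oneAddSq (hv (ns k)).1) (integrable_const _)
    (G := fun x => ∑ i, gradInv (u x) i * A x i j)
    (integrable_finsetSum _ fun i _ => (memLp_one_iff_integrable.1 (h1.memLp_jac i j)).bdd_mul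
      (c := 1) ((continuous_gradInv i).comp_aestronglyMeasurable hum)
      (Eventually.of_forall fun x => abs_gradInv_le _ _)) hconst
    (by simpa only [partialDeriv_inv_oneAddSq (hv _).1, Pi.mul_apply] using hsum)
  have hw2 : HasWeakPartial (unitBall n) j (fun _ => (1 / 2 : ℝ)) fun _ => 0 :=
    hasWeakPartial_of_tendsto (f := fun _ _ => (1 / 2 : ℝ)) (fun _ => contDiff_const)
      (integrable_const _) (integrable_const _) (by simp) (by simp [partialDeriv])
  filter_upwards [hw1.ae_eq hw2, hS] with x hx hSx
  have : ∑ i, gradInv (u x) i * A x i j = -(1 / 2) * ∑ i, u x i * A x i j := by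
    rw [Finset.mul_sum]
    refine Finset.sum_congr rfl fun i _ => ?_
    rw [gradInv, hSx]
    ring
  rw [this] at hx
  linarith

end AdmissiblePair

theorem jacobian_smul {g : E n → ℝ} {V : E n → E n} (hg : ContDiff ℝ ∞ g) (hV : ContDiff ℝ ∞ V)
    (x : E n) (i j : Fin n) :
    jacobian (fun y => g y • V y) x i j =
      g x * jacobian V x i j + V x i * partialDeriv j g x := by
  simp only [jacobian, Matrix.of_apply, partialDeriv, PiLp.smul_apply, smul_eq_mul]
  rw [fderiv_fun_mul (hg.differentiable (by simp) x)
    ((contDiff_coord hV i).differentiable (by simp) x)]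
  simp

/-- The integral of the sum of the principal minors of the weak Jacobian matrix of `g • u` depends
only on the boundary values. -/
theorem AdmissiblePair.integral_sumMinors_smul {p : ℕ} (hp : 1 ≤ p) {u : E n → E n}
    {A : E n → Matrix (Fin n) (Fin n) ℝ} (h : AdmissiblePair p u A) {g : E n → ℝ}
    (hg : ContDiff ℝ ∞ g) :
    ∫ x in unitBall n, sumMinors p (Matrix.of fun i j => g x * A x i j + u x i * partialDeriv j g x) =
      ∫ x in unitBall n, sumMinors p (jacobian (fun y => g y • y) x) := by
  have hp' : (1 : ℝ≥0∞) ≤ p := by exact_mod_cast hp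
  obtain ⟨v, hv, hvu, hvA⟩ := h.approx
  have hgp : ∀ j, Continuous fun x => partialDeriv j g x := fun j =>
    (contDiff_fderiv_apply hg _).continuous
  obtain ⟨C, hC⟩ := exists_bound_unitBall hg.continuous
  have hid : ContDiff ℝ ∞ fun x : E n => x := contDiff_id
  have hgid : ContDiff ℝ ∞ fun y : E n => g y • y := hg.smul hid
  have hsm : ∀ k, ContDiff ℝ ∞ fun y => g y • v k y := fun k => hg.smul (hv k).1
  have hm1 : ∀ i j, AEStronglyMeasurable (fun x => g x * A x i j) (ballMeasure n) := fun i j =>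
    hg.continuous.aestronglyMeasurable.mul (h.memLp_jac i j).1
  have hm2 : ∀ i j, AEStronglyMeasurable (fun x => u x i * partialDeriv j g x) (ballMeasure n) :=
    fun i j => (h.memLp_coord i).1.mul (hgp j).aestronglyMeasurable
  have hlim := (tendsto_integral_sumMinors (μ := ballMeasure n) hp
    (M := fun k => jacobian fun y => g y • v k y)
    (N := fun x => Matrix.of fun i j => g x * A x i j + u x i * partialDeriv j g x)
    (fun k i j => memLp_ballMeasure (continuous_jacobian (hsm k) i j) _) (fun i j => ?_)
    (fun i j => ?_)).2
  -- Since `g • v k` differs from `g • id` only on a compact subset of the ball, the sequence of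
  -- integrals is constant.
  · refine tendsto_nhds_unique hlim (tendsto_const_nhds.congr fun k => ?_)
    have hsub : Function.support (fun x => g x • v k x - g x • x) ⊆
        Function.support fun x => v k x - x := by
      intro x hx
      contrapose! hx
      rw [Function.notMem_support] at hx ⊢
      rw [← smul_sub, hx, smul_zero]
    refine (setIntegral_sumMinors_jacobian_eq hgid (hsm k) ?_ ?_ p).symm
    · exact (hv k).2.1.mono hsub
    · exact (closure_mono hsub).trans (hv k).2.2
  · obtain ⟨D, hD⟩ := exists_bound_unitBall (hgp j)
    refine MemLp.add ?_ ?_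
    · exact (h.memLp_jac i j).of_le_mul (c := C) (hm1 i j) (by
        filter_upwards [hC] with x hx
        rw [norm_mul]
        exact mul_le_mul_of_nonneg_right hx (norm_nonneg _))
    · exact (h.memLp_coord i).of_le_mul (c := D) (hm2 i j) (by
        filter_upwards [hD] with x hx
        rw [norm_mul, mul_comm]
        exact mul_le_mul_of_nonneg_right hx (norm_nonneg _))
  · obtain ⟨D, hD⟩ := exists_bound_unitBall (hgp j)
    simp only [jacobian_smul hg (hv _).1, Matrix.of_apply]
    refine tendsto_eLpNorm_add hp' (fun k => ?_) (hm1 i j) (fun k => ?_) (hm2 i j)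
      (tendsto_eLpNorm_bounded_mul hC (hvA i j)) ?_
    · exact (hg.continuous.mul (continuous_jacobian (hv k).1 i j)).aestronglyMeasurable
    · exact ((contDiff_coord (hv k).1 i).continuous.mul (hgp j)).aestronglyMeasurable
    · simp only [mul_comm _ (partialDeriv j g _)]
      exact tendsto_eLpNorm_bounded_mul hD (tendsto_eLpNorm_coord hvu i)

/-- A version of `AdmissiblePair.integral_sumMinors_smul` for limits of smooth weights. -/
theorem AdmissiblePair.integral_sumMinors_eq {p : ℕ} (hp : 1 ≤ p) {u₁ u₂ : E n → E n}
    {A₁ A₂ : E n → Matrix (Fin n) (Fin n) ℝ} (h₁ : AdmissiblePair p u₁ A₁)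
    (h₂ : AdmissiblePair p u₂ A₂) {g : ℕ → E n → ℝ} (hg : ∀ k, ContDiff ℝ ∞ (g k))
    {h : E n → ℝ} {d : E n → E n} {C : ℝ} {D : E n → ℝ}
    (hC : ∀ k, ∀ᵐ x ∂ballMeasure n, |g k x| ≤ C)
    (hD : ∀ k j, ∀ᵐ x ∂ballMeasure n, |partialDeriv j (g k) x| ≤ D x)
    (hDp : MemLp D p (ballMeasure n))
    (hgh : ∀ᵐ x ∂ballMeasure n, Tendsto (fun k => g k x) atTop (𝓝 (h x)))
    (hgd : ∀ j, ∀ᵐ x ∂ballMeasure n,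
      Tendsto (fun k => partialDeriv j (g k) x) atTop (𝓝 (d x j))) :
    Integrable (fun x => sumMinors p (Matrix.of fun i j => h x * A₁ x i j + u₁ x i * d x j))
      (ballMeasure n) ∧
    ∫ x in unitBall n, sumMinors p (Matrix.of fun i j => h x * A₁ x i j + u₁ x i * d x j) =
      ∫ x in unitBall n, sumMinors p (Matrix.of fun i j => h x * A₂ x i j + u₂ x i * d x j) := by
  have hp0 : (p : ℝ≥0∞) ≠ 0 := by
    simp only [ne_eq, Nat.cast_eq_zero]
    omega
  -- The approximating integrals involve the weight `g k` but not the pair, so any two pairs share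
  -- the same limit.
  have key : ∀ {u : E n → E n} {A : E n → Matrix (Fin n) (Fin n) ℝ}, AdmissiblePair p u A →
      Integrable (fun x => sumMinors p (Matrix.of fun i j => h x * A x i j + u x i * d x j))
        (ballMeasure n) ∧
      Tendsto (fun k => ∫ x in unitBall n, sumMinors p (jacobian (fun y => g k y • y) x)) atTop
        (𝓝 (∫ x in unitBall n,
          sumMinors p (Matrix.of fun i j => h x * A x i j + u x i * d x j))) := by
    intro u A hu
    have hmeas : ∀ k i j, AEStronglyMeasurable
        (fun x => g k x * A x i j + u x i * partialDeriv j (g k) x) (ballMeasure n) := fun k i j =>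
      ((hg k).continuous.aestronglyMeasurable.mul (hu.memLp_jac i j).1).add
        ((hu.memLp_coord i).1.mul (contDiff_fderiv_apply (hg k) _).continuous.aestronglyMeasurable)
    have hdom : ∀ i j, MemLp (fun x => C * |A x i j| + D x) p (ballMeasure n) := fun i j =>
      ((hu.memLp_jac i j).abs.const_mul C).add hDp
    have hbound : ∀ k i j, ∀ᵐ x ∂ballMeasure n,
        |g k x * A x i j + u x i * partialDeriv j (g k) x| ≤ C * |A x i j| + D x := by
      intro k i j
      filter_upwards [hC k, hD k j, hu.norm_eq] with x h1 h2 h3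
      refine (abs_add_le _ _).trans ?_
      rw [abs_mul, abs_mul]
      have h4 : |u x i| ≤ 1 := h3 ▸ PiLp.norm_apply_le (u x) i
      exact add_le_add (mul_le_mul_of_nonneg_right h1 (abs_nonneg _))
        ((mul_le_of_le_one_left (abs_nonneg _) h4).trans h2)
    have hlim : ∀ i j, ∀ᵐ x ∂ballMeasure n,
        Tendsto (fun k => g k x * A x i j + u x i * partialDeriv j (g k) x) atTop
          (𝓝 (h x * A x i j + u x i * d x j)) := by
      intro i j
      filter_upwards [hgh, hgd j] with x h1 h2
      exact (h1.mul_const _).add (h2.const_mul _)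
    have hdct := fun i j => tendsto_eLpNorm_of_dominated hp0 (ENNReal.natCast_ne_top p)
      (fun k => hmeas k i j) (hdom i j) (fun k => hbound k i j) (hlim i j)
    have := tendsto_integral_sumMinors (μ := ballMeasure n) hp
      (M := fun k x => Matrix.of fun i j => g k x * A x i j + u x i * partialDeriv j (g k) x)
      (N := fun x => Matrix.of fun i j => h x * A x i j + u x i * d x j)
      (fun k i j => (hdom i j).mono' (hmeas k i j) (hbound k i j)) (fun i j => (hdct i j).1)
      (fun i j => (hdct i j).2)
    refine ⟨this.1, this.2.congr fun k => ?_⟩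
    exact hu.integral_sumMinors_smul hp (hg k)
  exact ⟨(key h₁).1, tendsto_nhds_unique (key h₁).2 (key h₂).2⟩

end SphereValued

/-! ### The map `x / ‖x‖`: integrability and smooth approximation -/

section RadialMap

variable {n : ℕ}

theorem ae_mem_punctured_ball (hn : 0 < n) :
    ∀ᵐ x ∂ballMeasure n, 0 < ‖x‖ ∧ ‖x‖ < 1 := by
  have : Nonempty (Fin n) := ⟨⟨0, hn⟩⟩
  have h1 : ∀ᵐ x ∂ballMeasure n, x ≠ 0 := ae_restrict_of_ae (Measure.ae_ne volume 0)
  have h2 : ∀ᵐ x ∂ballMeasure n, x ∈ unitBall n := ae_restrict_mem isOpen_unitBall.measurableSet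
  filter_upwards [h1, h2] with x hx hx'
  exact ⟨norm_pos_iff.2 hx, by simpa [unitBall] using hx'⟩

theorem measurable_inv_norm : Measurable fun x : E n => ‖x‖⁻¹ := measurable_norm.inv

/-- In polar coordinates the integrand is `r^(n-1-p)`, a power with nonnegative exponent because `p
< n`. -/
theorem memLp_inv_norm {p : ℕ} (hp : 1 ≤ p) (hpn : p < n) :
    MemLp (fun x : E n => ‖x‖⁻¹) p (ballMeasure n) := by
  have hp0 : (p : ℝ≥0∞) ≠ 0 := by
    simp only [ne_eq, Nat.cast_eq_zero]
    omega
  rw [← integrable_norm_rpow_iff measurable_inv_norm.aestronglyMeasurable hp0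
    (ENNReal.natCast_ne_top p)]
  have : Nonempty (Fin n) := ⟨⟨0, by omega⟩⟩
  simp only [norm_inv, norm_norm, ENNReal.toReal_natCast, Real.rpow_natCast]
  have key := (integrableOn_fun_norm_addHaar (E := E n) (μ := volume) (f := fun t : ℝ => t⁻¹ ^ p)
    (r := 1)).2 ?_
  · exact key
  · have h1 : IntegrableOn (fun y : ℝ => y ^ (n - 1 - p)) (Set.Ioo 0 1) :=
      ((continuous_pow _).continuousOn.integrableOn_compact isCompact_Icc).mono_set
        Set.Ioo_subset_Icc_self
    refine h1.congr_fun (fun y hy => ?_) measurableSet_Ioo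
    have hy0 : y ≠ 0 := hy.1.ne'
    simp only [finrank_euclideanSpace, Fintype.card_fin, smul_eq_mul]
    rw [pow_sub₀ _ hy0 (by omega), inv_pow]

/-- The Jacobian matrix of `x / ‖x‖`. -/
noncomputable def radialJacobian (x : E n) : Matrix (Fin n) (Fin n) ℝ :=
  Matrix.of fun i j => ‖x‖⁻¹ * ((if i = j then 1 else 0) - radialMap n x i * radialMap n x j)

theorem norm_radialMap {x : E n} (hx : 0 < ‖x‖) : ‖radialMap n x‖ = 1 := by
  rw [radialMap, norm_smul, norm_inv, norm_norm, inv_mul_cancel₀ hx.ne']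

theorem radialMap_apply (x : E n) (i : Fin n) : radialMap n x i = ‖x‖⁻¹ * x i := by
  simp [radialMap]

theorem measurable_radialMap : Measurable (radialMap n) := by
  unfold radialMap
  exact measurable_inv_norm.smul measurable_id

/-- The matrix is `‖x‖⁻¹` times the orthogonal projection onto a hyperplane, and such a projection
has squared norm `n - 1`. -/
theorem hsNorm_radialJacobian {x : E n} (hx : 0 < ‖x‖) :
    hsNorm (radialJacobian x) = √((n - 1 : ℕ) : ℝ) * ‖x‖⁻¹ := by
  have hn : 1 ≤ n := by
    rcases Nat.eq_zero_or_pos n with rfl | h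
    · rw [Subsingleton.elim x 0, norm_zero] at hx
      exact absurd hx (lt_irrefl _)
    · exact h
  have h1 : ∑ i, radialMap n x i ^ 2 = 1 := by
    rw [← EuclideanSpace.real_norm_sq_eq, norm_radialMap hx, one_pow]
  have h2 : ∑ i, ∑ j, radialJacobian x i j ^ 2 = ((n - 1 : ℕ) : ℝ) * ‖x‖⁻¹ ^ 2 := by
    have h3 : ∀ i j, radialJacobian x i j ^ 2 = ‖x‖⁻¹ ^ 2 * ((if i = j then 1 else 0) -
        (if i = j then 2 * (radialMap n x i * radialMap n x j) else 0) +
        radialMap n x i ^ 2 * radialMap n x j ^ 2) := by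
      intro i j
      rw [radialJacobian, Matrix.of_apply]
      split_ifs <;> ring
    simp only [h3, ← Finset.mul_sum, Finset.sum_add_distrib, Finset.sum_sub_distrib,
      Finset.sum_ite_eq, Finset.mem_univ, if_true, h1, ← sq, Finset.sum_const, Finset.card_univ,
      Fintype.card_fin, nsmul_eq_mul, mul_one]
    push_cast [hn]
    ring
  rw [hsNorm, h2, Real.sqrt_mul (Nat.cast_nonneg _), Real.sqrt_sq (inv_nonneg.2 hx.le)]

section Cutoff

/-- The derivative is continuous and vanishes outside `[0, 1]`. The second clause confines the terms
of size `a` in the derivative of `radialFactor a` to the transition zones. -/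
theorem exists_bound_deriv_smoothTransition :
    ∃ L : ℝ, 0 ≤ L ∧ ∀ t, |deriv Real.smoothTransition t| ≤ L ∧
      (1 < t → deriv Real.smoothTransition t = 0) := by
  have hc : Continuous (deriv Real.smoothTransition) :=
    (Real.smoothTransition.contDiff (n := 1)).continuous_deriv le_rfl
  obtain ⟨L, hL⟩ := (isCompact_Icc (a := (0 : ℝ)) (b := 1)).exists_bound_of_continuousOn
    hc.continuousOn
  have hL0 : 0 ≤ L := (norm_nonneg _).trans (hL 0 (by simp))
  have h1 : ∀ t, 1 < t → deriv Real.smoothTransition t = 0 := by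
    intro t ht
    have : Real.smoothTransition =ᶠ[𝓝 t] fun _ => 1 := by
      filter_upwards [lt_mem_nhds ht] with s hs
      exact Real.smoothTransition.one_of_one_le hs.le
    rw [this.deriv_eq, deriv_const]
  have h0 : ∀ t, t < 0 → deriv Real.smoothTransition t = 0 := by
    intro t ht
    have : Real.smoothTransition =ᶠ[𝓝 t] fun _ => 0 := by
      filter_upwards [gt_mem_nhds ht] with s hs
      exact Real.smoothTransition.zero_of_nonpos hs.le
    rw [this.deriv_eq, deriv_const]
  refine ⟨L, hL0, fun t => ⟨?_, h1 t⟩⟩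
  rcases lt_or_ge t 0 with h | h
  · simpa [h0 t h] using hL0
  rcases lt_or_ge 1 t with h' | h'
  · simpa [h1 t h'] using hL0
  · exact hL t ⟨h, h'⟩

/-- A smooth approximation, as a function of `t = ‖x‖²`, of the factor `1 / ‖x‖`; it equals `1` near
`t = 0` and near `t = 1`. -/
noncomputable def radialFactor (a t : ℝ) : ℝ :=
  1 + Real.smoothTransition (a * t - 1) * Real.smoothTransition (a * (1 - t) - 1) * ((√t)⁻¹ - 1)

theorem radialFactor_eq_one_of_le {a t : ℝ} (h : a * t ≤ 1) : radialFactor a t = 1 := by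
  rw [radialFactor, Real.smoothTransition.zero_of_nonpos (by linarith)]
  ring

theorem radialFactor_eq_one_of_ge {a t : ℝ} (h : a * (1 - t) ≤ 1) : radialFactor a t = 1 := by
  rw [radialFactor, Real.smoothTransition.zero_of_nonpos (x := a * (1 - t) - 1) (by linarith)]
  ring

theorem radialFactor_eq_inv_sqrt {a t : ℝ} (h : 2 ≤ a * t) (h' : 2 ≤ a * (1 - t)) :
    radialFactor a t = (√t)⁻¹ := by
  rw [radialFactor, Real.smoothTransition.one_of_one_le (by linarith),
    Real.smoothTransition.one_of_one_le (by linarith)]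
  ring

/-- The square root is not smooth at `0`, but the factor is constant where `a * t < 1`; elsewhere `t
> 0`. -/
theorem contDiff_radialFactor {a : ℝ} (ha : 0 < a) : ContDiff ℝ ∞ (radialFactor a) := by
  rw [contDiff_iff_contDiffAt]
  intro t
  rcases lt_or_ge (a * t) 1 with h | h
  · have : radialFactor a =ᶠ[𝓝 t] fun _ => 1 := by
      have hc : Continuous fun s : ℝ => a * s := by fun_prop
      filter_upwards [hc.continuousAt.eventually_lt continuousAt_const h] with s hs
      exact radialFactor_eq_one_of_le hs.le
    exact contDiffAt_const.congr_of_eventuallyEq this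
  · have ht : 0 < t := pos_of_mul_pos_right (lt_of_lt_of_le one_pos h) ha.le
    have h1 : ContDiff ℝ ∞ fun t => Real.smoothTransition (a * t - 1) :=
      Real.smoothTransition.contDiff.comp (by fun_prop)
    have h2 : ContDiff ℝ ∞ fun t => Real.smoothTransition (a * (1 - t) - 1) :=
      Real.smoothTransition.contDiff.comp (by fun_prop)
    have h3 : ContDiffAt ℝ ∞ (fun t => (√t)⁻¹ - 1) t :=
      ((Real.contDiffAt_sqrt ht.ne').inv (Real.sqrt_pos.2 ht).ne').sub contDiffAt_const
    exact contDiffAt_const.add ((h1.contDiffAt.mul h2.contDiffAt).mul h3)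

theorem abs_radialFactor_le {a r : ℝ} (hr : 0 < r) (hr1 : r < 1) :
    |radialFactor a (r ^ 2)| ≤ r⁻¹ := by
  rw [radialFactor, Real.sqrt_sq hr.le]
  have h1 := Real.smoothTransition.nonneg (a * r ^ 2 - 1)
  have h2 := Real.smoothTransition.le_one (a * r ^ 2 - 1)
  have h3 := Real.smoothTransition.nonneg (a * (1 - r ^ 2) - 1)
  have h4 := Real.smoothTransition.le_one (a * (1 - r ^ 2) - 1)
  set p := Real.smoothTransition (a * r ^ 2 - 1)
  set q := Real.smoothTransition (a * (1 - r ^ 2) - 1)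
  have h5 : 0 ≤ p * q := mul_nonneg h1 h3
  have h6 : p * q ≤ 1 := mul_le_one₀ h2 h3 h4
  have h7 : 1 ≤ r⁻¹ := (one_le_inv₀ hr).2 hr1.le
  rw [abs_of_nonneg (by nlinarith)]
  nlinarith

/-- The bound must be uniform in `a`. Differentiating the inner cutoff produces `a`, but only where
`a r² ≤ 2`, so `a ≤ 2 r⁻²`. Near `r = 1` the outer cutoff also produces `a`, but multiplied by `r⁻¹
- 1`, and there `a (1 - r) ≤ 2`. These two terms give `2L` each, and the derivative of `1 / √t`
contributes at most `1`. -/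
theorem exists_bound_deriv_radialFactor :
    ∃ C : ℝ, 0 ≤ C ∧ ∀ a r : ℝ, 0 < a → 0 < r → r < 1 →
      |deriv (radialFactor a) (r ^ 2)| ≤ C * r⁻¹ ^ 3 := by
  obtain ⟨L, hL0, hL⟩ := exists_bound_deriv_smoothTransition
  refine ⟨4 * L + 1, by positivity, fun a r ha hr hr1 => ?_⟩
  have hr2 : 0 < r ^ 2 := by positivity
  have hsm : ∀ s, HasDerivAt Real.smoothTransition (deriv Real.smoothTransition s) s := fun s =>
    ((Real.smoothTransition.contDiff (n := 1)).differentiable (by simp) s).hasDerivAt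
  have d1 : HasDerivAt (fun t => Real.smoothTransition (a * t - 1))
      (deriv Real.smoothTransition (a * r ^ 2 - 1) * a) (r ^ 2) := by
    have : HasDerivAt (fun t : ℝ => a * t - 1) a (r ^ 2) := by
      simpa using ((hasDerivAt_id (r ^ 2)).const_mul a).sub_const 1
    exact (hsm _).comp (r ^ 2) this
  have d2 : HasDerivAt (fun t => Real.smoothTransition (a * (1 - t) - 1))
      (deriv Real.smoothTransition (a * (1 - r ^ 2) - 1) * (-a)) (r ^ 2) := by
    have : HasDerivAt (fun t : ℝ => a * (1 - t) - 1) (-a) (r ^ 2) := by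
      simpa using (((hasDerivAt_id (r ^ 2)).const_sub 1).const_mul a).sub_const 1
    exact (hsm _).comp (r ^ 2) this
  have d3 : HasDerivAt (fun t : ℝ => (√t)⁻¹ - 1) (-(1 / 2) * r⁻¹ ^ 3) (r ^ 2) := by
    have := ((Real.hasDerivAt_sqrt hr2.ne').fun_inv (Real.sqrt_pos.2 hr2).ne').sub_const 1
    refine this.congr_deriv ?_
    rw [Real.sqrt_sq hr.le]
    field_simp
  have d := (((d1.mul d2).mul d3).const_add 1).deriv
  have hd : deriv (radialFactor a) (r ^ 2) = _ := d
  rw [hd]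
  simp only [Pi.mul_apply, Real.sqrt_sq hr.le]
  have h1 := Real.smoothTransition.nonneg (a * r ^ 2 - 1)
  have h2 := Real.smoothTransition.le_one (a * r ^ 2 - 1)
  have h3 := Real.smoothTransition.nonneg (a * (1 - r ^ 2) - 1)
  have h4 := Real.smoothTransition.le_one (a * (1 - r ^ 2) - 1)
  have e1 : |deriv Real.smoothTransition (a * r ^ 2 - 1) * a| ≤ 2 * L * r⁻¹ ^ 2 := by
    rcases lt_or_ge 1 (a * r ^ 2 - 1) with h | h
    · rw [(hL _).2 h, zero_mul, abs_zero]
      positivity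
    · have ha2 : a ≤ 2 * r⁻¹ ^ 2 := by
        rw [inv_pow, ← div_eq_mul_inv, le_div_iff₀ hr2]
        linarith
      rw [abs_mul, abs_of_pos ha]
      calc _ ≤ L * (2 * r⁻¹ ^ 2) := mul_le_mul (hL _).1 ha2 ha.le hL0
        _ = _ := by ring
  have e2 : |deriv Real.smoothTransition (a * (1 - r ^ 2) - 1) * (-a)| * (r⁻¹ - 1) ≤
      2 * L * r⁻¹ := by
    rcases lt_or_ge 1 (a * (1 - r ^ 2) - 1) with h | h
    · rw [(hL _).2 h, zero_mul, abs_zero, zero_mul]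
      positivity
    · have h5 : a * (r⁻¹ - 1) ≤ 2 * r⁻¹ := by
        have : a * (r⁻¹ - 1) = a * (1 - r) * r⁻¹ := by field_simp
        rw [this]
        have : a * (1 - r) ≤ 2 := by nlinarith [mul_pos ha hr, mul_pos ha (sub_pos.2 hr1)]
        gcongr
      have h6 : 0 ≤ r⁻¹ - 1 := sub_nonneg.2 ((one_le_inv₀ hr).2 hr1.le)
      rw [abs_mul, abs_neg, abs_of_pos ha, mul_assoc]
      calc _ ≤ L * (2 * r⁻¹) := mul_le_mul (hL _).1 h5 (by positivity) hL0
        _ = _ := by ring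
  set p := Real.smoothTransition (a * r ^ 2 - 1)
  set q := Real.smoothTransition (a * (1 - r ^ 2) - 1)
  set p' := deriv Real.smoothTransition (a * r ^ 2 - 1) * a
  set q' := deriv Real.smoothTransition (a * (1 - r ^ 2) - 1) * (-a)
  have hs : 1 ≤ r⁻¹ := (one_le_inv₀ hr).2 hr1.le
  generalize r⁻¹ = s at *
  have hs2 : s ≤ s ^ 3 := by nlinarith [sq_nonneg s]
  have t1 : |p' * q * (s - 1)| ≤ 2 * L * s ^ 3 := by
    rw [abs_mul, abs_mul, abs_of_nonneg h3, abs_of_nonneg (sub_nonneg.2 hs)]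
    calc |p'| * q * (s - 1) ≤ (2 * L * s ^ 2) * 1 * s := by
          have : s - 1 ≤ s := by linarith
          gcongr
      _ = _ := by ring
  have t2 : |p * q' * (s - 1)| ≤ 2 * L * s ^ 3 := by
    rw [abs_mul, abs_mul, abs_of_nonneg h1, abs_of_nonneg (sub_nonneg.2 hs), mul_assoc]
    calc p * (|q'| * (s - 1)) ≤ 1 * (2 * L * s) :=
          mul_le_mul h2 e2 (mul_nonneg (abs_nonneg _) (by linarith)) zero_le_one
      _ = 2 * L * s := one_mul _
      _ ≤ _ := by gcongr
  have t3 : |p * q * (-(1 / 2) * s ^ 3)| ≤ s ^ 3 := by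
    have : p * q ≤ 1 := mul_le_one₀ h2 h3 h4
    rw [abs_mul, abs_mul, abs_mul, abs_of_nonneg h1, abs_of_nonneg h3, abs_neg,
      abs_of_nonneg (by positivity : (0 : ℝ) ≤ s ^ 3)]
    rw [abs_of_pos (by norm_num : (0 : ℝ) < 1 / 2)]
    have : 0 ≤ s ^ 3 := by positivity
    nlinarith
  calc _ = |p' * q * (s - 1) + p * q' * (s - 1) + p * q * (-(1 / 2) * s ^ 3)| := by
        congr 1
        ring
    _ ≤ |p' * q * (s - 1)| + |p * q' * (s - 1)| + |p * q * (-(1 / 2) * s ^ 3)| :=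
        abs_add_three _ _ _
    _ ≤ _ := by linarith

end Cutoff
theorem partialDeriv_comp_norm_sq {R : ℝ → ℝ} {x : E n} (hR : DifferentiableAt ℝ R (‖x‖ ^ 2))
    (j : Fin n) :
    partialDeriv j (fun y : E n => R (‖y‖ ^ 2)) x = deriv R (‖x‖ ^ 2) * (2 * x j) := by
  have h1 : HasFDerivAt (fun y : E n => ‖y‖ ^ 2) (2 • innerSL ℝ x) x :=
    (hasStrictFDerivAt_norm_sq x).hasFDerivAt
  have h2 := hR.hasDerivAt.comp_hasFDerivAt x h1
  rw [partialDeriv]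
  erw [h2.fderiv]
  simp [EuclideanSpace.inner_single_right]

theorem eventually_two_le_mul {t : ℝ} (ht : 0 < t) :
    ∀ᶠ k : ℕ in atTop, 2 < ((k : ℝ) + 1) * t := by
  have : Tendsto (fun k : ℕ => ((k : ℝ) + 1) * t) atTop atTop :=
    (tendsto_natCast_atTop_atTop.atTop_add tendsto_const_nhds).atTop_mul_const ht
  exact this.eventually_gt_atTop 2

/-- Once `k` is large, `r²` lies strictly between the two transition zones, so the factor coincides
with `1 / √t` on a neighbourhood. -/
theorem eventually_radialFactor {r : ℝ} (hr : 0 < r) (hr1 : r < 1) :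
    ∀ᶠ k : ℕ in atTop, radialFactor (k + 1) (r ^ 2) = r⁻¹ ∧
      deriv (radialFactor (k + 1)) (r ^ 2) = -(1 / 2) * r⁻¹ ^ 3 := by
  have hr2 : 0 < r ^ 2 := by positivity
  have hr3 : 0 < 1 - r ^ 2 := by nlinarith
  filter_upwards [eventually_two_le_mul hr2, eventually_two_le_mul hr3] with k h1 h2
  have hc1 : Continuous fun s : ℝ => ((k : ℝ) + 1) * s := by fun_prop
  have hc2 : Continuous fun s : ℝ => ((k : ℝ) + 1) * (1 - s) := by fun_prop
  have heq : radialFactor (k + 1) =ᶠ[𝓝 (r ^ 2)] fun t => (√t)⁻¹ := by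
    filter_upwards [continuousAt_const.eventually_lt hc1.continuousAt h1,
      continuousAt_const.eventually_lt hc2.continuousAt h2] with s h3 h4
    exact radialFactor_eq_inv_sqrt h3.le h4.le
  refine ⟨by rw [heq.eq_of_nhds, Real.sqrt_sq hr.le], ?_⟩
  rw [heq.deriv_eq, ((Real.hasDerivAt_sqrt hr2.ne').fun_inv (Real.sqrt_pos.2 hr2).ne').deriv,
    Real.sqrt_sq hr.le]
  field_simp

theorem one_apply_eq_ite (i j : Fin n) :
    (1 : Matrix (Fin n) (Fin n) ℝ) i j = if i = j then 1 else 0 := Matrix.one_apply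

/-- The map `x / ‖x‖` is a limit of smooth maps that agree with the identity near the boundary. -/
theorem admissiblePair_radialMap {p : ℕ} (hp : 1 ≤ p) (hpn : p < n) :
    AdmissiblePair p (radialMap n) radialJacobian := by
  have hp0 : (p : ℝ≥0∞) ≠ 0 := by
    simp only [ne_eq, Nat.cast_eq_zero]
    omega
  have hae := ae_mem_punctured_ball (n := n) (by omega)
  have hnorm : ∀ᵐ x ∂ballMeasure n, ‖radialMap n x‖ = 1 := by
    filter_upwards [hae] with x hx
    exact norm_radialMap hx.1
  have hmeas := (measurable_radialMap (n := n)).aestronglyMeasurable (μ := ballMeasure n)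
  obtain ⟨C, hC0, hC⟩ := exists_bound_deriv_radialFactor
  have hk : ∀ k : ℕ, (0 : ℝ) < k + 1 := fun k => by positivity
  set g : ℕ → E n → ℝ := fun k x => radialFactor (k + 1) (‖x‖ ^ 2) with hg
  have hgs : ∀ k, ContDiff ℝ ∞ (g k) := fun k =>
    (contDiff_radialFactor (hk k)).comp (contDiff_norm_sq ℝ)
  have hid : ContDiff ℝ ∞ fun x : E n => x := contDiff_id
  have hvs : ∀ k, ContDiff ℝ ∞ fun x => g k x • x := fun k => (hgs k).smul hid
  have hJ : ∀ k x i j, jacobian (fun x => g k x • x) x i j =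
      radialFactor (k + 1) (‖x‖ ^ 2) * (if i = j then 1 else 0) +
        x i * (deriv (radialFactor (k + 1)) (‖x‖ ^ 2) * (2 * x j)) := by
    intro k x i j
    rw [jacobian_smul (hgs k) hid, jacobian_id, one_apply_eq_ite,
      partialDeriv_comp_norm_sq ((contDiff_radialFactor (hk k)).differentiable (by simp) _)]
  have hDp := memLp_inv_norm hp hpn
  have hlimJ : ∀ i j, MemLp (fun x => radialJacobian x i j) p (ballMeasure n) ∧
      Tendsto (fun k => eLpNorm (fun x => jacobian (fun x => g k x • x) x i j -
        radialJacobian x i j) p (ballMeasure n)) atTop (𝓝 0) := by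
    intro i j
    -- In `hJ` the first term is at most `‖x‖⁻¹`; the second is at most `‖x‖ · C‖x‖⁻³ · 2‖x‖ =
    -- 2C‖x‖⁻¹`.
    refine tendsto_eLpNorm_of_dominated hp0 (ENNReal.natCast_ne_top p)
      (fun k => (continuous_jacobian (hvs k) i j).aestronglyMeasurable)
      (hDp.const_mul (1 + 2 * C)) (fun k => ?_) ?_
    · filter_upwards [hae] with x hx
      rw [hJ]
      have h1 := abs_radialFactor_le (a := k + 1) hx.1 hx.2
      have h2 := hC (k + 1) ‖x‖ (hk k) hx.1 hx.2
      have hi : |x i| ≤ ‖x‖ := PiLp.norm_apply_le x i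
      have hj : |x j| ≤ ‖x‖ := PiLp.norm_apply_le x j
      have hr := hx.1
      have hinv : 0 < ‖x‖⁻¹ := inv_pos.2 hr
      calc _ ≤ |radialFactor (k + 1) (‖x‖ ^ 2) * (if i = j then 1 else 0)| +
            |x i * (deriv (radialFactor (k + 1)) (‖x‖ ^ 2) * (2 * x j))| := abs_add_le _ _
        _ ≤ ‖x‖⁻¹ + ‖x‖ * (C * ‖x‖⁻¹ ^ 3 * (2 * ‖x‖)) := by
            rw [abs_mul, abs_mul, abs_mul, abs_mul, abs_two]
            refine add_le_add ((mul_le_of_le_one_right (abs_nonneg _) ?_).trans h1) ?_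
            · split_ifs <;> simp
            · gcongr
        _ = _ := by field_simp
    · filter_upwards [hae] with x hx
      refine tendsto_const_nhds.congr' ?_
      filter_upwards [eventually_radialFactor hx.1 hx.2] with k hk
      have hr := hx.1
      rw [hJ, hk.1, hk.2, radialJacobian, Matrix.of_apply, radialMap_apply, radialMap_apply]
      ring
  refine ⟨MemLp.of_bound hmeas 1 (hnorm.mono fun x hx => hx.le), fun i j => (hlimJ i j).1, hnorm,
    fun k x => g k x • x, fun k => ⟨hvs k, ?_⟩, ?_, fun i j => (hlimJ i j).2⟩
  -- Outside this ball `(k + 1)(1 - ‖x‖²) ≤ 1`, where the outer cutoff makes the factor equal to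
  -- one.
  · have hsupp : Function.support (fun x => g k x • x - x) ⊆
        Metric.closedBall (0 : E n) √(1 - 1 / (k + 1)) := by
      intro x hx
      contrapose! hx
      rw [mem_closedBall_zero_iff, not_le, Real.sqrt_lt (by
        rw [sub_nonneg, div_le_one (hk k)]
        exact le_add_of_nonneg_left (Nat.cast_nonneg k)) (norm_nonneg _)] at hx
      have h1 : ((k : ℝ) + 1) * (1 - ‖x‖ ^ 2) ≤ 1 := by
        have h2 : 1 - ‖x‖ ^ 2 ≤ 1 / ((k : ℝ) + 1) := by linarith
        rw [le_div_iff₀ (hk k)] at h2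
        linarith
      rw [Function.notMem_support, hg]
      simp only [radialFactor_eq_one_of_ge h1, one_smul, sub_self]
    refine ⟨HasCompactSupport.of_support_subset_isCompact (isCompact_closedBall _ _) hsupp,
      (closure_minimal hsupp Metric.isClosed_closedBall).trans
        (Metric.closedBall_subset_ball ?_)⟩
    rw [Real.sqrt_lt' one_pos]
    have : 0 < 1 / ((k : ℝ) + 1) := by positivity
    linarith
  · refine tendsto_eLpNorm_of_coord (by exact_mod_cast hp)
      (fun k => (hvs k).continuous.aestronglyMeasurable) hmeas fun i => ?_
    refine (tendsto_eLpNorm_of_dominated hp0 (ENNReal.natCast_ne_top p) (g := fun _ => 1)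
      (fun k => (contDiff_coord (hvs k) i).continuous.aestronglyMeasurable)
      (memLp_const 1) (fun k => ?_) ?_).2
    · filter_upwards [hae] with x hx
      have h1 := abs_radialFactor_le (a := k + 1) hx.1 hx.2
      have hi : |x i| ≤ ‖x‖ := PiLp.norm_apply_le x i
      simp only [PiLp.smul_apply, smul_eq_mul, abs_mul]
      calc _ ≤ ‖x‖⁻¹ * ‖x‖ := mul_le_mul h1 hi (abs_nonneg _) (inv_nonneg.2 hx.1.le)
        _ = 1 := inv_mul_cancel₀ hx.1.ne'
    · filter_upwards [hae] with x hx
      refine tendsto_const_nhds.congr' ?_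
      filter_upwards [eventually_radialFactor hx.1 hx.2] with k hk
      rw [radialMap_apply, PiLp.smul_apply, smul_eq_mul, hg]
      simp only [hk.1]

end RadialMap

/-! ### The singular weight `‖x‖^β` -/

section Weight

variable {n : ℕ}

/-- The gradient of `‖x‖ ^ β`. -/
noncomputable def weightGrad (β : ℝ) (x : E n) : E n := (β * ‖x‖ ^ (β - 2)) • x

/-- The weight is regularized to `(‖x‖² + ε)^(β/2)` with `ε = 1 / (k + 1)`. On the ball this is at
most `2^(β/2)`, and its partial derivatives are at most `β 2^(β/2) / ‖x‖`, which is in `L^p` because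
`p < n`. -/
theorem AdmissiblePair.integral_weighted_eq {p : ℕ} (hp : 1 ≤ p) (hpn : p < n) {β : ℝ} (hβ : 0 ≤ β)
    {u₁ u₂ : E n → E n} {A₁ A₂ : E n → Matrix (Fin n) (Fin n) ℝ} (h₁ : AdmissiblePair p u₁ A₁)
    (h₂ : AdmissiblePair p u₂ A₂) :
    Integrable (fun x => sumMinors p
      (Matrix.of fun i j => ‖x‖ ^ β * A₁ x i j + u₁ x i * weightGrad β x j)) (ballMeasure n) ∧
    ∫ x in unitBall n, sumMinors p
      (Matrix.of fun i j => ‖x‖ ^ β * A₁ x i j + u₁ x i * weightGrad β x j) =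
    ∫ x in unitBall n, sumMinors p
      (Matrix.of fun i j => ‖x‖ ^ β * A₂ x i j + u₂ x i * weightGrad β x j) := by
  have hae := ae_mem_punctured_ball (n := n) (by omega)
  have hε : ∀ k : ℕ, (0 : ℝ) < 1 / (k + 1) := fun k => by positivity
  have hε1 : ∀ k : ℕ, 1 / ((k : ℝ) + 1) ≤ 1 := fun k => by
    rw [div_le_one (by positivity)]
    exact le_add_of_nonneg_left (Nat.cast_nonneg k)
  have hpos : ∀ (k : ℕ) (x : E n), 0 < ‖x‖ ^ 2 + 1 / ((k : ℝ) + 1) := fun k x =>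
    add_pos_of_nonneg_of_pos (sq_nonneg _) (hε k)
  have hpd : ∀ (k : ℕ) (j : Fin n) (x : E n),
      partialDeriv j (fun y : E n => (‖y‖ ^ 2 + 1 / ((k : ℝ) + 1)) ^ (β / 2)) x =
        β * (‖x‖ ^ 2 + 1 / ((k : ℝ) + 1)) ^ (β / 2 - 1) * x j := by
    intro k j x
    have h1 : HasDerivAt (fun t : ℝ => (t + 1 / ((k : ℝ) + 1)) ^ (β / 2))
        (1 * (β / 2) * (‖x‖ ^ 2 + 1 / ((k : ℝ) + 1)) ^ (β / 2 - 1)) (‖x‖ ^ 2) :=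
      ((hasDerivAt_id (‖x‖ ^ 2)).add_const (1 / ((k : ℝ) + 1))).rpow_const (Or.inl (hpos k x).ne')
    rw [partialDeriv_comp_norm_sq (R := fun t : ℝ => (t + 1 / ((k : ℝ) + 1)) ^ (β / 2))
      h1.differentiableAt, h1.deriv]
    ring
  have hbd : ∀ k : ℕ, ∀ x : E n, ‖x‖ < 1 →
      (‖x‖ ^ 2 + 1 / ((k : ℝ) + 1)) ^ (β / 2) ≤ 2 ^ (β / 2) := by
    intro k x hx
    refine Real.rpow_le_rpow (hpos k x).le ?_ (by positivity)
    have := hε1 k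
    nlinarith [norm_nonneg x]
  have hlim0 : Tendsto (fun k : ℕ => 1 / ((k : ℝ) + 1)) atTop (𝓝 0) :=
    tendsto_one_div_add_atTop_nhds_zero_nat
  have hlim : ∀ (s : ℝ) (x : E n), 0 < ‖x‖ → Tendsto
      (fun k : ℕ => (‖x‖ ^ 2 + 1 / ((k : ℝ) + 1)) ^ (s / 2)) atTop (𝓝 (‖x‖ ^ s)) := by
    intro s x hx
    have h1 : (‖x‖ ^ 2) ^ (s / 2) = ‖x‖ ^ s := by
      rw [← Real.rpow_natCast, ← Real.rpow_mul hx.le]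
      congr 1
      push_cast
      ring
    rw [← h1]
    have h2 := (hlim0.const_add (‖x‖ ^ 2)).rpow_const (p := s / 2) (Or.inl (by
      rw [add_zero]
      positivity))
    rwa [add_zero] at h2
  refine h₁.integral_sumMinors_eq hp h₂
    (g := fun k x => (‖x‖ ^ 2 + 1 / ((k : ℝ) + 1)) ^ (β / 2)) (C := 2 ^ (β / 2))
    (D := fun x => β * 2 ^ (β / 2) * ‖x‖⁻¹) (fun k => ?_) (fun k => ?_) (fun k j => ?_)
    ((memLp_inv_norm hp hpn).const_mul _) ?_ fun j => ?_
  · exact ((contDiff_norm_sq ℝ).add contDiff_const).rpow_const_of_ne fun x => (hpos k x).ne'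
  · filter_upwards [hae] with x hx
    rw [abs_of_nonneg (Real.rpow_nonneg (hpos k x).le _)]
    exact hbd k x hx.2
  · filter_upwards [hae] with x hx
    have hj : |x j| ≤ ‖x‖ := PiLp.norm_apply_le x j
    have hr := hx.1
    rw [hpd, abs_mul, abs_mul, abs_of_nonneg hβ, abs_of_nonneg (Real.rpow_nonneg (hpos k x).le _),
      Real.rpow_sub_one (hpos k x).ne']
    calc β * ((‖x‖ ^ 2 + 1 / ((k : ℝ) + 1)) ^ (β / 2) / (‖x‖ ^ 2 + 1 / ((k : ℝ) + 1))) * |x j| ≤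
        β * (2 ^ (β / 2) / ‖x‖ ^ 2) * ‖x‖ := by
          have h1 := hbd k x hx.2
          have h2 : ‖x‖ ^ 2 ≤ ‖x‖ ^ 2 + 1 / ((k : ℝ) + 1) := le_add_of_nonneg_right (hε k).le
          gcongr
      _ = _ := by field_simp
  · filter_upwards [hae] with x hx
    exact hlim β x hx.1
  · filter_upwards [hae] with x hx
    have h1 := ((hlim (β - 2) x hx.1).const_mul β).mul_const (x j)
    have h2 : (β - 2) / 2 = β / 2 - 1 := by ring
    rw [h2] at h1
    exact h1.congr fun k => (hpd k j x).symm

end Weight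

/-! ### Calibration inequality, minimality and uniqueness -/

section Minimality

variable {n : ℕ}

/-- Weighted AM–GM with a remainder, which supplies the equality case. The deficits on the right
satisfy `D (k+1) = ρ D k + (k+2) s^(k+1) (s - ρ)²`. -/
theorem pow_mul_sq_le_weighted_amgm {s ρ : ℝ} (hs : 0 ≤ s) (hρ : 0 ≤ ρ) (k : ℕ) :
    ρ ^ k * (s - ρ) ^ 2 ≤ (k + 1) * s ^ (k + 2) + ρ ^ (k + 2) - (k + 2) * (ρ * s ^ (k + 1)) := by
  induction k with
  | zero =>
    refine le_of_eq ?_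
    push_cast
    ring
  | succ k ih =>
    have h1 := mul_le_mul_of_nonneg_left ih hρ
    have h2 : 0 ≤ ((k : ℝ) + 2) * s ^ (k + 1) * (s - ρ) ^ 2 := by positivity
    push_cast
    linear_combination h1 + h2

theorem weighted_amgm {s ρ : ℝ} (hs : 0 ≤ s) (hρ : 0 ≤ ρ) (k : ℕ) :
    (k + 1) * (ρ * s ^ k) ≤ k * s ^ (k + 1) + ρ ^ (k + 1) := by
  cases k with
  | zero => simp
  | succ k =>
    have h1 := pow_mul_sq_le_weighted_amgm hs hρ k
    have h2 : 0 ≤ ρ ^ k * (s - ρ) ^ 2 := by positivity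
    push_cast
    linear_combination h1 + h2

theorem weightGrad_apply {x : E n} (hx : 0 < ‖x‖) (β : ℝ) (j : Fin n) :
    weightGrad β x j = β * ‖x‖ ^ β * ‖x‖⁻¹ * radialMap n x j := by
  rw [weightGrad, PiLp.smul_apply, smul_eq_mul, radialMap_apply, Real.rpow_sub hx]
  norm_num
  field_simp

theorem norm_weightGrad {x : E n} (hx : 0 < ‖x‖) {β : ℝ} (hβ : 0 ≤ β) :
    ‖weightGrad β x‖ = β * ‖x‖ ^ β * ‖x‖⁻¹ := by
  have h : weightGrad β x = (β * ‖x‖ ^ β * ‖x‖⁻¹) • radialMap n x := by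
    ext j
    rw [weightGrad_apply hx, PiLp.smul_apply, smul_eq_mul]
  rw [h, norm_smul, norm_radialMap hx, mul_one, Real.norm_of_nonneg (by positivity)]

/-- This explains the exponent `α / p`: minors of order `p` are homogeneous of degree `p`, which
restores the weight `‖x‖^α`. -/
theorem rpow_div_natCast_pow {r α : ℝ} (hr : 0 ≤ r) (k : ℕ) :
    (r ^ (α / (k + 1 : ℕ))) ^ (k + 1) = r ^ α := by
  rw [← Real.rpow_natCast, ← Real.rpow_mul hr, div_mul_cancel₀]
  positivity

/-- The pointwise bound for the null Lagrangian of the weighted map by the energy density. -/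
theorem sumMinors_weighted_le {x u : E n} (hx : 0 < ‖x‖) (hu : ‖u‖ = 1)
    {A : Matrix (Fin n) (Fin n) ℝ} (hA : ∀ j, ∑ i, u i * A i j = 0) {α : ℝ} (hα : 0 ≤ α) (k : ℕ) :
    sumMinors (k + 1) (Matrix.of fun i j =>
      ‖x‖ ^ (α / (k + 1 : ℕ)) * A i j + u i * weightGrad (α / (k + 1 : ℕ)) x j) ≤
      ((n - 1).choose (k + 1) : ℝ) * (‖x‖ ^ α * (hsNorm A / √((n - 1 : ℕ) : ℝ)) ^ (k + 1)) +
      α / (k + 1 : ℕ) * ((n - 1).choose k : ℝ) *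
        (‖x‖ ^ α * (‖x‖⁻¹ * (hsNorm A / √((n - 1 : ℕ) : ℝ)) ^ k)) := by
  have hβ : 0 ≤ α / (k + 1 : ℕ) := by positivity
  refine (sumMinors_le u hu A hA (weightGrad (α / (k + 1 : ℕ)) x)
    (Real.rpow_nonneg hx.le _) k).trans_eq ?_
  rw [norm_weightGrad hx hβ, ← rpow_div_natCast_pow (α := α) hx.le k]
  ring

/-- The gradient of the weight is parallel to `x / ‖x‖` and the tangential part is a multiple of a
projection, so the estimate of `sumMinors_weighted_le` is an equality here. -/
theorem sumMinors_weighted_radial {x : E n} (hx : 0 < ‖x‖) (α : ℝ) (k : ℕ) :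
    sumMinors (k + 1) (Matrix.of fun i j => ‖x‖ ^ (α / (k + 1 : ℕ)) * radialJacobian x i j +
      radialMap n x i * weightGrad (α / (k + 1 : ℕ)) x j) =
      (((n - 1).choose (k + 1) : ℝ) + α / (k + 1 : ℕ) * ((n - 1).choose k : ℝ)) *
        (‖x‖ ^ α * ‖x‖⁻¹ ^ (k + 1)) := by
  have h : (Matrix.of fun i j => ‖x‖ ^ (α / (k + 1 : ℕ)) * radialJacobian x i j +
      radialMap n x i * weightGrad (α / (k + 1 : ℕ)) x j) = Matrix.of fun i j =>
      (‖x‖ ^ (α / (k + 1 : ℕ)) * ‖x‖⁻¹) *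
        ((if i = j then 1 else 0) - radialMap n x i * radialMap n x j) +
      (α / (k + 1 : ℕ) * ‖x‖ ^ (α / (k + 1 : ℕ)) * ‖x‖⁻¹) *
        (radialMap n x i * radialMap n x j) := by
    ext i j
    simp only [Matrix.of_apply, radialJacobian, weightGrad_apply hx]
    ring
  rw [h, sumMinors_projection _ (norm_radialMap hx), ← rpow_div_natCast_pow (α := α) hx.le k]
  ring

theorem memLp_hsNorm {p : ℝ≥0∞} {A : E n → Matrix (Fin n) (Fin n) ℝ}
    (hA : ∀ i j, MemLp (fun x => A x i j) p (ballMeasure n)) :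
    MemLp (fun x => hsNorm (A x)) p (ballMeasure n) := by
  have hm : AEStronglyMeasurable (fun x => hsNorm (A x)) (ballMeasure n) := by
    have h1 : AEMeasurable (fun x => ∑ i, ∑ j, A x i j ^ 2) (ballMeasure n) :=
      Finset.aemeasurable_fun_sum _ fun i _ => Finset.aemeasurable_fun_sum _ fun j _ =>
        (hA i j).1.aemeasurable.pow_const 2
    exact (Real.continuous_sqrt.measurable.comp_aemeasurable h1).aestronglyMeasurable
  refine (memLp_finsetSum Finset.univ fun i _ => memLp_finsetSum Finset.univ fun j _ =>
    (hA i j).abs).mono' hm (Eventually.of_forall fun x => ?_)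
  rw [Real.norm_of_nonneg (hsNorm_nonneg _)]
  refine Real.sqrt_le_iff.2 ⟨Finset.sum_nonneg fun _ _ => Finset.sum_nonneg fun _ _ =>
    abs_nonneg _, ?_⟩
  calc ∑ i, ∑ j, A x i j ^ 2 ≤ ∑ i, (∑ j, |A x i j|) ^ 2 := by
        refine Finset.sum_le_sum fun i _ => ?_
        simp only [← sq_abs (A x i _)]
        exact Finset.sum_sq_le_sq_sum_of_nonneg fun _ _ => abs_nonneg _
    _ ≤ _ := Finset.sum_sq_le_sq_sum_of_nonneg fun _ _ =>
        Finset.sum_nonneg fun _ _ => abs_nonneg _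

theorem integrable_weight_mul {α : ℝ} (hα : 0 ≤ α) {f : E n → ℝ}
    (hf : Integrable f (ballMeasure n)) :
    Integrable (fun x => ‖x‖ ^ α * f x) (ballMeasure n) := by
  refine hf.bdd_mul (c := 1) (measurable_norm.pow_const α).aestronglyMeasurable ?_
  filter_upwards [ae_restrict_mem isOpen_unitBall.measurableSet] with x hx
  have h1 : ‖x‖ ≤ 1 := by
    have : ‖x‖ < 1 := by simpa [unitBall] using hx
    exact this.le
  rw [Real.norm_of_nonneg (Real.rpow_nonneg (norm_nonneg _) _)]
  exact Real.rpow_le_one (norm_nonneg _) h1 hα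

theorem integrable_energyDensity {p : ℕ} (hp : 1 ≤ p) {α : ℝ} (hα : 0 ≤ α)
    {A : E n → Matrix (Fin n) (Fin n) ℝ} (hA : ∀ i j, MemLp (fun x => A x i j) p (ballMeasure n)) :
    Integrable (fun x => ‖x‖ ^ α * hsNorm (A x) ^ p) (ballMeasure n) := by
  refine integrable_weight_mul hα ?_
  have := (memLp_hsNorm hA).integrable_norm_pow (by omega)
  simpa only [Real.norm_of_nonneg (hsNorm_nonneg _)] using this

theorem AdmissiblePair.energy_eq {p : ℕ} (hp : 1 ≤ p) {α : ℝ} (hα : 0 ≤ α) {u : E n → E n}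
    {A : E n → Matrix (Fin n) (Fin n) ℝ} (h : AdmissiblePair p u A) :
    energy n α p u = ENNReal.ofReal (∫ x, ‖x‖ ^ α * hsNorm (A x) ^ p ∂ballMeasure n) := by
  have hae := (h.isWeakJacobian (by exact_mod_cast hp)).weakJacobian_ae_eq
  rw [ofReal_integral_eq_lintegral_ofReal (integrable_energyDensity hp hα h.memLp_jac)
    (Eventually.of_forall fun x => mul_nonneg (Real.rpow_nonneg (norm_nonneg _) _)
      (pow_nonneg (hsNorm_nonneg _) _)), energy]
  refine lintegral_congr_ae ?_
  filter_upwards [hae] with x hx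
  rw [hx, Real.rpow_natCast]

theorem AdmissiblePair.congr_ae {p : ℝ≥0∞} {u v : E n → E n}
    {A : E n → Matrix (Fin n) (Fin n) ℝ} (h : AdmissiblePair p u A) (huv : v =ᵐ[ballMeasure n] u) :
    AdmissiblePair p v A := by
  obtain ⟨w, hw, hwu, hwA⟩ := h.approx
  refine ⟨(memLp_congr_ae huv).2 h.memLp, h.memLp_jac, ?_, w, hw, ?_, hwA⟩
  · filter_upwards [huv, h.norm_eq] with x hx hx'
    rw [hx, hx']
  · refine hwu.congr fun k => eLpNorm_congr_ae ?_
    filter_upwards [huv] with x hx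
    rw [hx]

/-- Minimality of `x / ‖x‖`, with the case of equality for exponents greater than one. -/
theorem AdmissiblePair.integral_energyDensity_le {k : ℕ} (hkn : k + 1 < n) {α : ℝ} (hα : 0 ≤ α)
    {u : E n → E n} {A : E n → Matrix (Fin n) (Fin n) ℝ} (h : AdmissiblePair (k + 1 : ℕ) u A) :
    ∫ x, ‖x‖ ^ α * hsNorm (radialJacobian x) ^ (k + 1) ∂ballMeasure n ≤
      ∫ x, ‖x‖ ^ α * hsNorm (A x) ^ (k + 1) ∂ballMeasure n ∧
    (0 < α → 0 < k →
      ∫ x, ‖x‖ ^ α * hsNorm (radialJacobian x) ^ (k + 1) ∂ballMeasure n =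
        ∫ x, ‖x‖ ^ α * hsNorm (A x) ^ (k + 1) ∂ballMeasure n →
      ∀ᵐ x ∂ballMeasure n, hsNorm (A x) = hsNorm (radialJacobian x)) := by
  have hp : 1 ≤ k + 1 := by omega
  have hae := ae_mem_punctured_ball (n := n) (by omega)
  have h0 := admissiblePair_radialMap hp hkn
  set l : ℝ := √((n - 1 : ℕ) : ℝ) with hl
  have hl0 : 0 < l := Real.sqrt_pos.2 (by exact_mod_cast (by omega : 0 < n - 1))
  set β : ℝ := α / (k + 1 : ℕ) with hβdef
  have hβ : 0 ≤ β := by positivity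
  set C₁ : ℝ := ((n - 1).choose (k + 1) : ℝ) with hC₁
  set C₂ : ℝ := ((n - 1).choose k : ℝ) with hC₂
  have hC₁0 : 0 < C₁ := Nat.cast_pos.2 (Nat.choose_pos (by omega))
  have hC₂0 : 0 < C₂ := Nat.cast_pos.2 (Nat.choose_pos (by omega))
  -- Chosen so that AM–GM reads `β C₂ ρ s^k ≤ c (k s^(k+1) + ρ^(k+1))`; `K` then collects the
  -- coefficients of `s^(k+1)`, and `K + c = C₁ + β C₂` is the coefficient for the radial map.
  set c : ℝ := β * C₂ / (k + 1) with hc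
  have hc0 : 0 ≤ c := by positivity
  have hck : c * (k + 1) = β * C₂ := by
    rw [hc]
    field_simp
  set K : ℝ := C₁ + c * k with hK
  have hK0 : 0 < K := by positivity
  obtain ⟨hint, heq⟩ := h.integral_weighted_eq hp hkn hβ h0
  obtain ⟨hint0, -⟩ := h0.integral_weighted_eq hp hkn hβ h0
  set σ : E n → ℝ := fun x => sumMinors (k + 1)
    (Matrix.of fun i j => ‖x‖ ^ β * A x i j + u x i * weightGrad β x j) with hσ
  set S : E n → ℝ := fun x => ‖x‖ ^ α * hsNorm (A x) ^ (k + 1) with hS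
  set R : E n → ℝ := fun x => ‖x‖ ^ α * hsNorm (radialJacobian x) ^ (k + 1) with hR
  have hSi : Integrable S (ballMeasure n) := integrable_energyDensity hp hα h.memLp_jac
  have hRi : Integrable R (ballMeasure n) := integrable_energyDensity hp hα h0.memLp_jac
  have hRx : ∀ x : E n, 0 < ‖x‖ → R x / l ^ (k + 1) = ‖x‖ ^ α * ‖x‖⁻¹ ^ (k + 1) := by
    intro x hx
    simp only [hR, hsNorm_radialJacobian hx, ← hl, mul_pow]
    field_simp
  have hσ0 : ∫ x, σ x ∂ballMeasure n = (K + c) * ((∫ x, R x ∂ballMeasure n) / l ^ (k + 1)) := by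
    rw [← integral_div, ← integral_const_mul]
    refine heq.trans (integral_congr_ae ?_)
    filter_upwards [hae] with x hx
    rw [sumMinors_weighted_radial hx.1, hRx x hx.1, ← hβdef]
    congr 1
    linear_combination -hck
  -- The AM–GM gap is kept on the left, since the case of equality is read off from it.
  have hbound : ∀ᵐ x ∂ballMeasure n, c * (‖x‖ ^ α * (k * (hsNorm (A x) / l) ^ (k + 1) +
      ‖x‖⁻¹ ^ (k + 1) - (k + 1) * (‖x‖⁻¹ * (hsNorm (A x) / l) ^ k))) ≤
      K * (S x / l ^ (k + 1)) + c * (R x / l ^ (k + 1)) - σ x := by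
    filter_upwards [hae, h.norm_eq, h.tangent (by exact_mod_cast hp)] with x hx hux htx
    have h1 := sumMinors_weighted_le hx.1 hux htx hα k
    have h2 : S x / l ^ (k + 1) = ‖x‖ ^ α * (hsNorm (A x) / l) ^ (k + 1) := by
      simp only [hS, div_pow]
      ring
    rw [hRx x hx.1, h2, hK]
    simp only [← hβdef, ← hl, ← hC₁, ← hC₂] at h1
    rw [← hck] at h1
    simp only [hσ]
    linear_combination h1
  have hgap : ∀ x : E n, 0 ≤ ‖x‖ ^ α * (k * (hsNorm (A x) / l) ^ (k + 1) +
      ‖x‖⁻¹ ^ (k + 1) - (k + 1) * (‖x‖⁻¹ * (hsNorm (A x) / l) ^ k)) := fun x =>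
    mul_nonneg (Real.rpow_nonneg (norm_nonneg _) _) (sub_nonneg.2 (weighted_amgm
      (div_nonneg (hsNorm_nonneg _) hl0.le) (inv_nonneg.2 (norm_nonneg _)) k))
  have hSRi : Integrable (fun x => K * (S x / l ^ (k + 1)) + c * (R x / l ^ (k + 1)))
      (ballMeasure n) := ((hSi.div_const _).const_mul _).add ((hRi.div_const _).const_mul _)
  have hfi : Integrable (fun x => K * (S x / l ^ (k + 1)) + c * (R x / l ^ (k + 1)) - σ x)
      (ballMeasure n) := hSRi.sub hint
  have hf0 : 0 ≤ᵐ[ballMeasure n]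
      fun x => K * (S x / l ^ (k + 1)) + c * (R x / l ^ (k + 1)) - σ x := by
    filter_upwards [hbound] with x hx
    exact (mul_nonneg hc0 (hgap x)).trans hx
  -- The integral of `σ` is that of the radial map, so the multiples of `c` cancel and only the
  -- energy difference remains.
  have hfint : ∫ x, (K * (S x / l ^ (k + 1)) + c * (R x / l ^ (k + 1)) - σ x) ∂ballMeasure n =
      K / l ^ (k + 1) * ((∫ x, S x ∂ballMeasure n) - ∫ x, R x ∂ballMeasure n) := by
    rw [integral_sub hSRi hint,
      integral_add ((hSi.div_const _).const_mul _) ((hRi.div_const _).const_mul _),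
      integral_const_mul, integral_const_mul, integral_div, integral_div, hσ0]
    ring
  have hKl : 0 < K / l ^ (k + 1) := by positivity
  refine ⟨?_, fun hα0 hk0 he => ?_⟩
  · have := integral_nonneg_of_ae hf0
    rw [hfint] at this
    exact sub_nonneg.1 (nonneg_of_mul_nonneg_right this hKl)
  -- Equal energies make the nonnegative deficit vanish almost everywhere. Here `α > 0` gives `c >
  -- 0`, and `k > 0` makes the square `(s - ρ)²` available in the AM–GM remainder.
  · have hz := (integral_eq_zero_iff_of_nonneg_ae hf0 hfi).1 (by rw [hfint, he, sub_self, mul_zero])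
    have hc1 : 0 < c := by
      have : 0 < β := by positivity
      positivity
    filter_upwards [hbound, hz, hae] with x hx hzx hx0
    simp only [Pi.zero_apply] at hzx
    rw [hzx] at hx
    have hw : 0 < ‖x‖ ^ α := Real.rpow_pos_of_pos hx0.1 _
    have hg := nonpos_of_mul_nonpos_right (nonpos_of_mul_nonpos_right hx hc1) hw
    obtain ⟨m, rfl⟩ : ∃ m, k = m + 1 := ⟨k - 1, by omega⟩
    have hρ : 0 < ‖x‖⁻¹ := inv_pos.2 hx0.1
    have hsq := pow_mul_sq_le_weighted_amgm (div_nonneg (hsNorm_nonneg (A x)) hl0.le) hρ.le m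
    push_cast at hg
    have h1 : ‖x‖⁻¹ ^ m * (hsNorm (A x) / l - ‖x‖⁻¹) ^ 2 ≤ 0 := by
      linear_combination hsq + hg
    have h2 : (hsNorm (A x) / l - ‖x‖⁻¹) ^ 2 = 0 :=
      le_antisymm (nonpos_of_mul_nonpos_right h1 (by positivity)) (sq_nonneg _)
    have h3 : hsNorm (A x) / l = ‖x‖⁻¹ := sub_eq_zero.1 (pow_eq_zero_iff two_ne_zero |>.1 h2)
    rw [hsNorm_radialJacobian hx0.1, ← hl, ← h3]
    field_simp

/-- The case of order one in `sumMinors_le`, with weight one and no gradient term; tangency improves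
the constant from `√n` to `√(n-1)`. -/
theorem trace_le_hsNorm (hn : 1 < n) {u : E n} (hu : ‖u‖ = 1) {A : Matrix (Fin n) (Fin n) ℝ}
    (hA : ∀ j, ∑ i, u i * A i j = 0) : A.trace ≤ √((n - 1 : ℕ) : ℝ) * hsNorm A := by
  have h := sumMinors_le u hu A hA 0 zero_le_one 0
  have hM : (Matrix.of fun i j => 1 * A i j + u i * (0 : E n) j) = A := by
    ext i j
    simp
  have hpos : (0 : ℝ) < ((n - 1 : ℕ) : ℝ) := by exact_mod_cast (by omega : 0 < n - 1)
  rw [hM, zero_add, sumMinors_one] at h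
  refine h.trans_eq ?_
  have h2 : √((n - 1 : ℕ) : ℝ) ≠ 0 := (Real.sqrt_pos.2 hpos).ne'
  have h3 : ((n - 1 : ℕ) : ℝ) = √((n - 1 : ℕ) : ℝ) * √((n - 1 : ℕ) : ℝ) :=
    (Real.mul_self_sqrt hpos.le).symm
  simp only [Nat.choose_one_right, norm_zero, zero_mul, add_zero, one_mul, pow_one]
  rw [mul_div_assoc', div_eq_iff h2]
  linear_combination hsNorm A * h3

/-- This is the divergence of `‖x‖^α u`. Its last term sees the direction of `u` itself, which the
energy density does not. -/
theorem sumMinors_one_weighted {x : E n} (hx : 0 < ‖x‖) (u : E n) (A : Matrix (Fin n) (Fin n) ℝ)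
    (α : ℝ) :
    sumMinors 1 (Matrix.of fun i j => ‖x‖ ^ α * A i j + u i * weightGrad α x j) =
      ‖x‖ ^ α * A.trace + α * ‖x‖ ^ α * ‖x‖⁻¹ * inner ℝ u (radialMap n x) := by
  rw [sumMinors_one]
  simp only [Matrix.trace, Matrix.diag_apply, Matrix.of_apply, Finset.sum_add_distrib,
    weightGrad_apply hx, PiLp.inner_apply, Finset.mul_sum]
  congr 1
  refine Finset.sum_congr rfl fun i _ => ?_
  simp only [RCLike.inner_apply, conj_trivial]
  ring

/-- An admissible map whose energy with exponent one is minimal is equal to `x / ‖x‖`. -/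
theorem AdmissiblePair.ae_eq_radialMap (hn : 1 < n) {α : ℝ} (hα : 0 < α) {u : E n → E n}
    {A : E n → Matrix (Fin n) (Fin n) ℝ} (h : AdmissiblePair 1 u A)
    (hle : ∫ x, ‖x‖ ^ α * hsNorm (A x) ^ 1 ∂ballMeasure n ≤
      ∫ x, ‖x‖ ^ α * hsNorm (radialJacobian x) ^ 1 ∂ballMeasure n) :
    u =ᵐ[ballMeasure n] radialMap n := by
  have hae := ae_mem_punctured_ball (n := n) (by omega)
  have h : AdmissiblePair (1 : ℕ) u A := by simpa using h
  have h0 := admissiblePair_radialMap (n := n) le_rfl hn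
  have hpos : (0 : ℝ) < ((n - 1 : ℕ) : ℝ) := by exact_mod_cast (by omega : 0 < n - 1)
  obtain ⟨hint, heq⟩ := h.integral_weighted_eq le_rfl hn hα.le h0
  obtain ⟨hint0, -⟩ := h0.integral_weighted_eq le_rfl hn hα.le h0
  have hSi := integrable_energyDensity le_rfl hα.le h.memLp_jac
  have hRi := integrable_energyDensity le_rfl hα.le h0.memLp_jac
  simp only [pow_one] at hSi hRi hle
  set l : ℝ := √((n - 1 : ℕ) : ℝ) with hl
  have hl0 : 0 ≤ l := Real.sqrt_nonneg _
  have hgap0 : ∀ᵐ x ∂ballMeasure n,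
      0 ≤ α * (‖x‖ ^ α * (‖x‖⁻¹ * (1 - inner ℝ (u x) (radialMap n x)))) := by
    filter_upwards [hae, h.norm_eq] with x hx hux
    have h1 : inner ℝ (u x) (radialMap n x) ≤ 1 := by
      simpa [hux, norm_radialMap hx.1] using real_inner_le_norm (u x) (radialMap n x)
    have h2 : 0 ≤ 1 - inner ℝ (u x) (radialMap n x) := by linarith
    positivity
  have hgi : Integrable (fun x => α * (‖x‖ ^ α * (‖x‖⁻¹ * (1 - inner ℝ (u x) (radialMap n x)))))
      (ballMeasure n) := by
    refine (integrable_weight_mul hα.le ?_).const_mul α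
    have h1 : Integrable (fun x : E n => ‖x‖⁻¹) (ballMeasure n) := by
      have := memLp_inv_norm (n := n) le_rfl hn
      rw [Nat.cast_one] at this
      exact memLp_one_iff_integrable.1 this
    refine h1.mul_bdd (c := 2) (aestronglyMeasurable_const.sub
      (h.memLp.1.inner measurable_radialMap.aestronglyMeasurable)) ?_
    filter_upwards [hae, h.norm_eq] with x hx hux
    have h2 : |inner ℝ (u x) (radialMap n x)| ≤ 1 := by
      simpa [hux, norm_radialMap hx.1] using abs_real_inner_le_norm (u x) (radialMap n x)
    rw [Real.norm_eq_abs, abs_le]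
    constructor <;> linarith [abs_le.1 h2]
  have hSRi : Integrable (fun x => l * (‖x‖ ^ α * hsNorm (A x)) -
      l * (‖x‖ ^ α * hsNorm (radialJacobian x))) (ballMeasure n) :=
    (hSi.const_mul l).sub (hRi.const_mul l)
  have hint2 : Integrable (fun x => l * (‖x‖ ^ α * hsNorm (A x)) -
      l * (‖x‖ ^ α * hsNorm (radialJacobian x)) -
      α * (‖x‖ ^ α * (‖x‖⁻¹ * (1 - inner ℝ (u x) (radialMap n x))))) (ballMeasure n) :=
    hSRi.sub hgi
  -- The two divergences have equal integrals, and the trace bound is an equality for the radial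
  -- map. Integration therefore bounds the defect `∫ α ‖x‖^(α-1) (1 - ⟨u, u₀⟩)` by `l` times the
  -- energy difference, which is nonpositive by `hle`.
  have hmono := integral_mono_ae (hint.sub hint0) hint2 (by
    filter_upwards [hae, h.norm_eq, h.tangent (by simp)] with x hx hux htx
    have h1 := trace_le_hsNorm hn hux htx
    have h2 : (radialJacobian x).trace = l * hsNorm (radialJacobian x) := by
      -- With exponent `0` the weight disappears and the formula of order one gives the trace.
      have h3 := sumMinors_weighted_radial hx.1 0 0
      rw [zero_add, sumMinors_one_weighted hx.1] at h3
      simp only [Real.rpow_zero, zero_div, zero_mul, add_zero, one_mul, Nat.choose_one_right,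
        pow_one] at h3
      rw [hsNorm_radialJacobian hx.1, ← hl, ← mul_assoc, Real.mul_self_sqrt hpos.le]
      exact h3
    simp only [Pi.sub_apply]
    rw [sumMinors_one_weighted hx.1, sumMinors_one_weighted hx.1, h2, real_inner_self_eq_norm_sq,
      norm_radialMap hx.1]
    have hw : 0 ≤ ‖x‖ ^ α := Real.rpow_nonneg hx.1.le _
    have h3 := mul_le_mul_of_nonneg_left h1 hw
    linear_combination h3)
  rw [integral_sub' hint hint0, heq, sub_self, integral_sub hSRi hgi,
    integral_sub (hSi.const_mul l) (hRi.const_mul l), integral_const_mul,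
    integral_const_mul] at hmono
  have hzero : ∫ x, α * (‖x‖ ^ α * (‖x‖⁻¹ * (1 - inner ℝ (u x) (radialMap n x)))) ∂ballMeasure n =
      0 := by
    refine le_antisymm ?_ (integral_nonneg_of_ae hgap0)
    have := mul_le_mul_of_nonneg_left hle hl0
    linarith
  filter_upwards [(integral_eq_zero_iff_of_nonneg_ae hgap0 hgi).1 hzero, hae, h.norm_eq]
    with x hx hx0 hux
  have hw : ‖x‖ ^ α ≠ 0 := (Real.rpow_pos_of_pos hx0.1 _).ne'
  have h1 : 1 - inner ℝ (u x) (radialMap n x) = 0 := by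
    simpa [hα.ne', hw, hx0.1.ne'] using hx
  exact (inner_eq_one_iff_of_norm_eq_one (𝕜 := ℝ) hux (norm_radialMap hx0.1)).1
    (sub_eq_zero.1 h1).symm

end Minimality
end WeightedEnergy

theorem theorem0p2 (n p : ℕ) (hp : 1 ≤ p) (hpn : p ≤ n - 1) (α : ℝ) (hα : 0 ≤ α) :
    WeightedEnergy.Admissible n p (WeightedEnergy.radialMap n) ∧
    WeightedEnergy.energy n α p (WeightedEnergy.radialMap n) < ⊤ ∧
    (∀ u : WeightedEnergy.E n → WeightedEnergy.E n, WeightedEnergy.Admissible n p u →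
      WeightedEnergy.energy n α p (WeightedEnergy.radialMap n) ≤ WeightedEnergy.energy n α p u) ∧
    (0 < α → ∀ u : WeightedEnergy.E n → WeightedEnergy.E n, WeightedEnergy.Admissible n p u →
      (WeightedEnergy.energy n α p u = WeightedEnergy.energy n α p (WeightedEnergy.radialMap n) ↔
        u =ᵐ[volume.restrict (WeightedEnergy.unitBall n)] WeightedEnergy.radialMap n)) := by
  open WeightedEnergy in
  -- Together with `1 ≤ p`, the truncated subtraction `n - 1` already forces `n ≥ 2`.
  have hlt : p < n := by omega
  have hp' : (1 : ℝ≥0∞) ≤ p := by exact_mod_cast hp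
  have h0 := admissiblePair_radialMap hp hlt
  have hE0 := h0.energy_eq hp hα
  obtain ⟨k, rfl⟩ : ∃ k, p = k + 1 := ⟨p - 1, by omega⟩
  refine ⟨h0.admissible hp', by rw [hE0]; exact ENNReal.ofReal_lt_top, fun u hu => ?_,
    fun hα0 u hu => ⟨fun he => ?_, fun he => ?_⟩⟩
  · have h := hu.admissiblePair hp'
    rw [hE0, h.energy_eq hp hα]
    exact ENNReal.ofReal_le_ofReal (h.integral_energyDensity_le hlt hα).1
  · have h := hu.admissiblePair hp'
    have hnn : ∀ B : E n → Matrix (Fin n) (Fin n) ℝ,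
        0 ≤ ∫ x, ‖x‖ ^ α * hsNorm (B x) ^ (k + 1) ∂ballMeasure n := fun B =>
      integral_nonneg fun x => mul_nonneg (Real.rpow_nonneg (norm_nonneg _) _)
        (pow_nonneg (hsNorm_nonneg _) _)
    rw [hE0, h.energy_eq hp hα, ENNReal.ofReal_eq_ofReal_iff (hnn _) (hnn _)] at he
    refine (h.mono hp').ae_eq_radialMap (by omega) hα0 ?_
    -- For `p = 1` the required comparison of exponent-one energies is the assumption itself; for `p
    -- ≥ 2` it follows from the pointwise equality of the norms.
    rcases Nat.eq_zero_or_pos k with rfl | hk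
    · exact he.le
    · have hae := (h.integral_energyDensity_le hlt hα).2 hα0 hk he.symm
      refine (integral_congr_ae ?_).le
      filter_upwards [hae] with x hx
      rw [hx]
  · rw [hE0, (h0.congr_ae he).energy_eq hp hα]
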